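/- Let $X_1,X_2,\dots$ be i.i.d. $\mathcal N(0,1)$ random variables (the null hypothesis), let $\sigma>0$, and let $n$ be the sample size. A configuration is a vector $\hat y=(\hat y_{11},\dots,\hat y_{n1})\in[0,1]^n$; put $\hat y_{i0}=1-\hat y_{i1}$ and $0\log 0=0$. Define $$f(\hat y)=\sum_{i=1}^n\bigl\{\hat y_{i1}\log\hat y_{i1}+(1-\hat y_{i1})\log(1-\hat y_{i1})\bigr\}-\frac{\bigl(\sum_i X_i\hat y_{i1}\bigr)^2}{2\bigl(\sum_i\hat y_{i1}+1/\sigma^2\bigr)},$$ and, for the hyperparameter $\phi>0$ (mixing ratio $a$ with prior $\propto(1-a)^{\phi-1}a^{\phi-1}$, mean of the second component with prior $\mathcal N(0,\sigma^2)$), let the variational free energy relative to the null hypothesis be $$(F-F_0)(\hat y)=f(\hat y)+\log\frac{\Gamma(n+2\phi)}{\Gamma(\sum_i\hat y_{i0}+\phi)\,\Gamma(\sum_i\hat y_{i1}+\phi)}+\frac12\log\Bigl(1+\sigma^2\sum_i\hat y_{i1}\Bigr)-\log\frac{\Gamma(2\phi)}{\Gamma(\phi)^2}.$$ On the set of all configurations,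 and for $0\le n_1\le n$ on the set of those with $\sum_i\hat y_{i1}=n_1$, the functionals $f$ (in the constrained case) and $F-F_0$ (in both cases) attain their minima. Let $n_1=n_1(n)>0$ be a deterministic real sequence with $n_1/n\to0$ as $n\to\infty$. (a) If $n_1^2/n\to0$, then $$\min_{\sum_i\hat y_{i1}=n_1}f(\hat y)=-n_1\log n+n_1\log n_1-n_1+o_p(1).$$ In the whole regime $n_1/n\to0$, $$\min_{\sum_i\hat y_{i1}=n_1}f(\hat y)=-n_1\log n+n_1\log n_1+(n-n_1)\log\Bigl(1-\frac{n_1}{n}\Bigr)+O_p(1).$$ (b) If $n_1$ is bounded below by a positive constant (and $n_1/n\to0$), then for every $\phi>0$ $$\min_{\sum_i\hat y_{i1}=n_1}(F-F_0)(\hat y)=\phi\log\frac n{n_1}+\log n_1+O_p(1).$$ (c) There is a phase transition at the critical hyperparameter $\phi_{\rm cr}=1$: for every $\phi>0$, as $n\to\infty$, $$\frac{1}{\log n}\min_{\hat y\in[0,1]^n}(F-F_0)(\hat y)\longrightarrow\begin{cases}\phi&(\phi<1)\\1&(\phi\ge1)\end{cases}\qquad\text{in probability},$$ and $\phi=1$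 is the only point of $(0,\infty)$ at which this limit is not differentiable in $\phi$. -/

import Mathlib

open MeasureTheory ProbabilityTheory Filter Topology

noncomputable section

/-- The configurations `y i = ŷ_{i1} ∈ [0,1]`; the weight of the other component is
`ŷ_{i0} = 1 - y i`. -/
def Configs (n : ℕ) : Set (Fin n → ℝ) :=
  {y | ∀ i, 0 ≤ y i ∧ y i ≤ 1}

/-- The configurations with prescribed total weight `∑ ŷ_{i1} = m`. -/
def ConfigsWithSum (n : ℕ) (m : ℝ) : Set (Fin n → ℝ) :=
  {y | y ∈ Configs n ∧ ∑ i, y i = m}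

/-- The entropy term `∑ᵢ ∑ₖ ŷ_{ik} log ŷ_{ik}`, with `0 log 0 = 0`. -/
def entropyTerm {n : ℕ} (y : Fin n → ℝ) : ℝ :=
  ∑ i, (y i * Real.log (y i) + (1 - y i) * Real.log (1 - y i))

/-- The quadratic term `(∑ Xᵢ ŷ_{i1})² / (2 (∑ ŷ_{i1} + 1/σ²))`. -/
def quadraticTerm (σ : ℝ) {n : ℕ} (x y : Fin n → ℝ) : ℝ :=
  (∑ i, x i * y i) ^ 2 / (2 * (∑ i, y i + 1 / σ ^ 2))

/-- The entropy-minus-quadratic functional `f`. -/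
def entropyMinusQuadratic (σ : ℝ) {n : ℕ} (x y : Fin n → ℝ) : ℝ :=
  entropyTerm y - quadraticTerm σ x y

/-- `F - F₀` as a function of the configuration, for the prior
`φ(a) ∝ (1 - a)^(φ-1) a^(φ-1)` on the mixing ratio and `N(0, σ²)` on the mean. -/
def freeEnergyGap (φ σ : ℝ) {n : ℕ} (x y : Fin n → ℝ) : ℝ :=
  entropyTerm y
    + Real.log (Real.Gamma (n + 2 * φ) /
        (Real.Gamma (∑ i, (1 - y i) + φ) * Real.Gamma (∑ i, y i + φ)))
    + 1 / 2 * Real.log (1 + σ ^ 2 * ∑ i, y i)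
    - quadraticTerm σ x y
    - Real.log (Real.Gamma (2 * φ) / (Real.Gamma φ * Real.Gamma φ))

/-- The minimum of `f` under the constraint `∑ ŷ_{i1} = m`. -/
def minEntropyMinusQuadratic (σ : ℝ) {n : ℕ} (x : Fin n → ℝ) (m : ℝ) : ℝ :=
  sInf (entropyMinusQuadratic σ x '' ConfigsWithSum n m)

/-- The minimum of `F - F₀` under the constraint `∑ ŷ_{i1} = m`. -/
def minFreeEnergyGapWithSum (φ σ : ℝ) {n : ℕ} (x : Fin n → ℝ) (m : ℝ) : ℝ :=
  sInf (freeEnergyGap φ σ x '' ConfigsWithSum n m)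

/-- The minimum of `F - F₀` over all configurations. -/
def minFreeEnergyGap (φ σ : ℝ) {n : ℕ} (x : Fin n → ℝ) : ℝ :=
  sInf (freeEnergyGap φ σ x '' Configs n)

/-- The first `n` observations. -/
def sample {Ω : Type*} (X : ℕ → Ω → ℝ) (n : ℕ) (ω : Ω) : Fin n → ℝ :=
  fun i => X i ω

/-- `R n = O_p(1)` as `n → ∞`. -/
def IsBoundedInProbability {Ω : Type*} [MeasurableSpace Ω] (μ : Measure Ω)
    (R : ℕ → Ω → ℝ) : Prop :=
  ∀ ε : ENNReal, 0 < ε → ∃ M : ℝ, ∀ᶠ n in atTop, μ {ω | M < |R n ω|} ≤ ε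

end

/-! Fix the total weight `m` and put `p = m / n`. Writing the quadratic term as `max_t (t S - t² A /
2)`, with `S = ∑ xᵢ yᵢ` and `A = m + 1/σ²`, turns `f` into an entropy with a linear tilt. The Gibbs
variational inequality then gives `f ≥ entropyMin n m - (ℓ(t) - t²/(2σ²))` for some `t`, where
`ℓ(t)` is the log-likelihood ratio of `(1-p) N(0,1) + p N(t,1)` against `N(0,1)`
(`exists_entropyMin_sub_logLikelihood_le`). The constant configuration gives `f ≤ entropyMin n m`.
So the random part of the minimum lies between `0` and the supremum over `t` of the penalized
likelihood ratio.

That supremum is controlled under the null through the square root `g(t) = exp(ℓ(t)/2)`. Since `g(0)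
= 1`, the excess of `g(t) exp(-c t²)` over `1` is at most the integral of `|g'(s)| exp(-c s²)`.
Cauchy–Schwarz bounds `E|g'|` by a Fisher-information factor times a power of the Hellinger
affinity. Where the score is large the affinity is small, and the expected integral is bounded
uniformly in `n` and in `p ≤ 1/2` (`exists_lintegral_dampedVariation_le`); it vanishes when `n p² =
m²/n → 0` (`tendsto_variationBound`). Markov's inequality yields the `O_p(1)` and `o_p(1)`
statements.

The rest of the free energy depends on `m` only. By Stirling, `entropyMin + mixingCost` is `φ log
(n/m) + log m + O(1)` for `m` between a positive constant and `n/2`; this is monotone in `log m`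
with slope `1 - φ`, so its optimum sits at `m` of order `1` for `φ < 1` and of order `n` for `φ >
1`. Minimizing over all weights requires control at all `p` simultaneously: a dyadic grid of `O(log
n)` ratios suffices, because Bernoulli's inequality compares ratios within a factor `2`, and an
error `ε log n` is affordable. -/

/-! ### Stirling's formula for `log Γ`, uniform on half-lines. -/

/-- From `log u ≤ sinh (log u) = (u - 1/u)/2` at `u = (x+1)/x`. The excess over `1` is written as a
difference so that it telescopes along `x, x+1, ...`. -/
lemma log_one_add_inv_le {x : ℝ} (hx : 0 < x) :
    (x + 1 / 2) * (Real.log (x + 1) - Real.log x) ≤ 1 + (1 / (4 * x) - 1 / (4 * (x + 1))) := by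
  have h1 : 1 ≤ (x + 1) / x := by rw [le_div_iff₀ hx]; linarith
  have h2 : Real.log ((x + 1) / x) ≤ ((x + 1) / x - ((x + 1) / x)⁻¹) / 2 := by
    rw [← Real.sinh_log (by positivity)]
    exact Real.self_le_sinh_iff.2 (Real.log_nonneg h1)
  rw [← Real.log_div (by positivity) hx.ne']
  calc _ ≤ (x + 1 / 2) * (((x + 1) / x - ((x + 1) / x)⁻¹) / 2) := by gcongr
    _ = _ := by field_simp; ring

lemma one_le_log_one_add_inv {x : ℝ} (hx : 0 < x) :
    1 ≤ (x + 1 / 2) * (Real.log (x + 1) - Real.log x) := by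
  have h := Real.le_log_one_add_of_nonneg (x := 1 / x) (by positivity)
  rw [← Real.log_div (by positivity) hx.ne']
  have e : (x + 1) / x = 1 + 1 / x := by field_simp
  rw [e]
  calc (1 : ℝ) = (x + 1 / 2) * (2 * (1 / x) / (1 / x + 2)) := by field_simp; ring
    _ ≤ _ := by gcongr

/-- The error term in Stirling's formula for `log Γ`. -/
noncomputable def stirlingError (x : ℝ) : ℝ :=
  Real.log (Real.Gamma x) - ((x - 1 / 2) * Real.log x - x)

lemma stirlingError_add_one {x : ℝ} (hx : 0 < x) :
    stirlingError (x + 1)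
      = stirlingError x + (1 - (x + 1 / 2) * (Real.log (x + 1) - Real.log x)) := by
  unfold stirlingError
  rw [Real.Gamma_add_one hx.ne', Real.log_mul hx.ne' (Real.Gamma_pos_of_pos hx).ne']
  ring

/-- Along `x + ℕ` the error decreases while the error minus `1/(4x)` increases, so its values stay
trapped near the initial one. -/
lemma stirlingError_add_nat {x : ℝ} (hx : 0 < x) (k : ℕ) :
    stirlingError (x + k) ≤ stirlingError x ∧
      stirlingError x - 1 / (4 * x) ≤ stirlingError (x + k) - 1 / (4 * (x + k)) := by
  induction k with
  | zero => simp
  | succ k ih =>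
    have hk : 0 < x + k := by positivity
    have := log_one_add_inv_le hk
    have := one_le_log_one_add_inv hk
    push_cast
    rw [← add_assoc, stirlingError_add_one hk]
    constructor <;> linarith [ih.1, ih.2]

lemma differentiableAt_Gamma_of_pos {x : ℝ} (hx : 0 < x) : DifferentiableAt ℝ Real.Gamma x :=
  Real.differentiableAt_Gamma fun m h => by
    have : (0 : ℝ) ≤ m := m.cast_nonneg
    linarith

lemma exists_abs_stirlingError_le {φ : ℝ} (hφ : 0 < φ) :
    ∃ C, ∀ x, φ ≤ x → |stirlingError x| ≤ C := by
  have hc : ContinuousOn stirlingError (Set.Icc φ (φ + 1)) := by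
    intro x hx
    have hx0 : 0 < x := hφ.trans_le hx.1
    have h1 : ContinuousAt Real.Gamma x :=
      (differentiableAt_Gamma_of_pos hx0).continuousAt
    have h2 : Real.Gamma x ≠ 0 := (Real.Gamma_pos_of_pos hx0).ne'
    have h3 := hx0.ne'
    unfold stirlingError
    apply ContinuousAt.continuousWithinAt
    fun_prop (disch := assumption)
  obtain ⟨C, hC⟩ := isCompact_Icc.exists_bound_of_continuousOn hc
  refine ⟨C + 1 / (4 * φ), fun x hx => ?_⟩
  have h0 : 0 ≤ x - φ := by linarith
  have hf := Nat.floor_le h0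
  have hf' := Nat.lt_floor_add_one (x - φ)
  -- An integer shift brings `x` back into `[φ, φ+1]`, where the error is bounded by compactness.
  set k := ⌊x - φ⌋₊
  have hy : φ ≤ x - k := by linarith
  have hy0 : 0 < x - k := by linarith
  have h := stirlingError_add_nat hy0 k
  have hb := hC (x - k) ⟨hy, by linarith⟩
  rw [sub_add_cancel] at h
  rw [Real.norm_eq_abs, abs_le] at hb
  have h1 : 1 / (4 * (x - k)) ≤ 1 / (4 * φ) := by gcongr
  have h2 : 0 < 1 / (4 * x) := by have := hφ.trans_le hx; positivity
  have h3 : 0 < 1 / (4 * φ) := by positivity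
  rw [abs_le]
  constructor <;> linarith [h.1, h.2, hb.1, hb.2]

/-- `x + φ` lies between `x + 1` and `φ (x + 1)`. The reference `log (x + 1)` is independent of `φ`
and harmless at `x = 0`. -/
lemma abs_log_add_sub_log_add_le {φ x : ℝ} (hφ : 0 < φ) (hx : 0 ≤ x) :
    |Real.log (x + φ) - Real.log (x + 1)| ≤ |Real.log φ| := by
  have h1 : 0 < x + φ := by positivity
  have h2 : 0 < x + 1 := by positivity
  rcases le_total φ 1 with h | h
  · rw [abs_of_nonpos (Real.log_nonpos hφ.le h), abs_of_nonpos
      (sub_nonpos.2 (Real.log_le_log h1 (by linarith)))]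
    have : Real.log (φ * (x + 1)) ≤ Real.log (x + φ) :=
      Real.log_le_log (by positivity) (by nlinarith)
    rw [Real.log_mul hφ.ne' h2.ne'] at this
    linarith
  · rw [abs_of_nonneg (Real.log_nonneg h), abs_of_nonneg
      (sub_nonneg.2 (Real.log_le_log h2 (by linarith)))]
    have : Real.log (x + φ) ≤ Real.log (φ * (x + 1)) :=
      Real.log_le_log (by positivity) (by nlinarith)
    rw [Real.log_mul hφ.ne' h2.ne'] at this
    linarith

/-- Stirling's formula for `log Γ(x + φ)`, uniformly in `x ≥ 0`. -/
lemma exists_abs_log_Gamma_add_sub_le {φ : ℝ} (hφ : 0 < φ) :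
    ∃ C, ∀ x, 0 ≤ x → |Real.log (Real.Gamma (x + φ))
      - (x * Real.log x - x + (φ - 1 / 2) * Real.log (x + 1))| ≤ C := by
  obtain ⟨C, hC⟩ := exists_abs_stirlingError_le hφ
  refine ⟨C + φ + |φ - 1 / 2| * |Real.log φ|, fun x hx => ?_⟩
  have h := hC (x + φ) (by linarith)
  have h1 := abs_log_add_sub_log_add_le hφ hx
  have h2 : 0 ≤ x * (Real.log (x + φ) - Real.log x) ∧
      x * (Real.log (x + φ) - Real.log x) ≤ φ := by
    rcases hx.eq_or_lt with rfl | hx0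
    · simp [hφ.le]
    · constructor
      · exact mul_nonneg hx (sub_nonneg.2 (Real.log_le_log hx0 (by linarith)))
      · rw [← Real.log_div (by positivity) hx0.ne']
        have := Real.log_le_sub_one_of_pos (x := (x + φ) / x) (by positivity)
        calc _ ≤ x * ((x + φ) / x - 1) := by gcongr
          _ = φ := by field_simp; ring
  have h3 : |(φ - 1 / 2) * (Real.log (x + φ) - Real.log (x + 1))| ≤ |φ - 1 / 2| * |Real.log φ| := by
    rw [abs_mul]; gcongr
  unfold stirlingError at h
  rw [abs_le] at h h3 ⊢
  constructor <;> nlinarith [h.1, h.2, h3.1, h3.2, h2.1, h2.2]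

/-! ### The deterministic cost of a given total weight. -/

/-- The minimum `n h(m/n)` of the entropy term over the configurations of total weight `m`. -/
noncomputable def entropyMin (n : ℕ) (m : ℝ) : ℝ :=
  m * Real.log m + (n - m) * Real.log (n - m) - n * Real.log n

/-- The part of the free energy gap that depends on the total weight only. -/
noncomputable def mixingCost (φ σ : ℝ) (n : ℕ) (m : ℝ) : ℝ :=
  Real.log (Real.Gamma (n + 2 * φ) / (Real.Gamma (n - m + φ) * Real.Gamma (m + φ)))
    + 1 / 2 * Real.log (1 + σ ^ 2 * m)
    - Real.log (Real.Gamma (2 * φ) / (Real.Gamma φ * Real.Gamma φ))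

lemma abs_log_one_add_mul_sub_le {s m : ℝ} (hs : 0 < s) (hm : 0 ≤ m) :
    |Real.log (1 + s * m) - Real.log (m + 1)| ≤ |Real.log s| := by
  have h1 : 0 < 1 + s * m := by positivity
  have h2 : 0 < m + 1 := by positivity
  rcases le_total s 1 with h | h
  · rw [abs_of_nonpos (Real.log_nonpos hs.le h), abs_of_nonpos
      (sub_nonpos.2 (Real.log_le_log h1 (by nlinarith)))]
    have : Real.log (s * (m + 1)) ≤ Real.log (1 + s * m) :=
      Real.log_le_log (by positivity) (by nlinarith)
    rw [Real.log_mul hs.ne' h2.ne'] at this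
    linarith
  · rw [abs_of_nonneg (Real.log_nonneg h), abs_of_nonneg
      (sub_nonneg.2 (Real.log_le_log h2 (by nlinarith)))]
    have : Real.log (1 + s * m) ≤ Real.log (s * (m + 1)) :=
      Real.log_le_log (by positivity) (by nlinarith)
    rw [Real.log_mul hs.ne' h2.ne'] at this
    linarith

/-- The leading `x log x - x` terms of the three Gamma factors cancel exactly against `entropyMin`.
The term `log (1 + σ² m) / 2` shifts the coefficient of `log (m + 1)` from `φ - 1/2` to `φ - 1`,
which is the source of the critical value. -/
lemma exists_abs_entropyMin_add_mixingCost_sub_le {φ σ : ℝ} (hφ : 0 < φ) (hσ : 0 < σ) :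
    ∃ C, ∀ (n : ℕ) (m : ℝ), 0 ≤ m → m ≤ n →
      |entropyMin n m + mixingCost φ σ n m - ((2 * φ - 1 / 2) * Real.log (n + 1)
        - (φ - 1 / 2) * Real.log (n - m + 1) - (φ - 1) * Real.log (m + 1))| ≤ C := by
  obtain ⟨C₁, h₁⟩ := exists_abs_log_Gamma_add_sub_le hφ
  obtain ⟨C₂, h₂⟩ := exists_abs_log_Gamma_add_sub_le (φ := 2 * φ) (by positivity)
  refine ⟨C₂ + 2 * C₁ + |Real.log (σ ^ 2)|
    + |Real.log (Real.Gamma (2 * φ) / (Real.Gamma φ * Real.Gamma φ))|, fun n m h0 hn => ?_⟩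
  have hn0 : (0 : ℝ) ≤ n := n.cast_nonneg
  have a1 := h₁ m h0
  have a2 := h₁ (n - m) (by linarith)
  have a3 := h₂ n hn0
  have a4 := abs_log_one_add_mul_sub_le (s := σ ^ 2) (by positivity) h0
  have a5 := le_abs_self (Real.log (Real.Gamma (2 * φ) / (Real.Gamma φ * Real.Gamma φ)))
  have a6 := neg_le_abs (Real.log (Real.Gamma (2 * φ) / (Real.Gamma φ * Real.Gamma φ)))
  have a7 := abs_nonneg (Real.log (σ ^ 2))
  unfold entropyMin mixingCost
  have g1 := (Real.Gamma_pos_of_pos (s := n + 2 * φ) (by positivity)).ne'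
  have g2 := (Real.Gamma_pos_of_pos (s := n - m + φ) (by linarith)).ne'
  have g3 := (Real.Gamma_pos_of_pos (s := m + φ) (by positivity)).ne'
  rw [Real.log_div g1 (mul_ne_zero g2 g3), Real.log_mul g2 g3]
  rw [abs_le] at a1 a2 a3 a4 ⊢
  constructor <;> linarith [a1.1, a1.2, a2.1, a2.2, a3.1, a3.2, a4.1, a4.2]

lemma freeEnergyGap_eq (φ σ : ℝ) {n : ℕ} (x y : Fin n → ℝ) :
    freeEnergyGap φ σ x y = entropyMinusQuadratic σ x y + mixingCost φ σ n (∑ i, y i) := by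
  unfold freeEnergyGap entropyMinusQuadratic mixingCost
  have : ∑ i, (1 - y i) = n - ∑ i, y i := by simp
  rw [this]; ring

/-! ### Compactness and attainment of the minima. -/

lemma configs_eq (n : ℕ) : Configs n = Set.Icc 0 1 := by
  ext y; simp [Configs, Set.mem_Icc, Pi.le_def, forall_and]

lemma isCompact_configs (n : ℕ) : IsCompact (Configs n) := by
  rw [configs_eq]; exact isCompact_Icc

lemma isCompact_configsWithSum (n : ℕ) (m : ℝ) : IsCompact (ConfigsWithSum n m) := by
  have : ConfigsWithSum n m = Configs n ∩ {y | ∑ i, y i = m} := rfl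
  rw [this]
  exact (isCompact_configs n).inter_right (isClosed_eq (by fun_prop) continuous_const)

lemma sum_nonneg_of_mem_configs {n : ℕ} {y : Fin n → ℝ} (hy : y ∈ Configs n) : 0 ≤ ∑ i, y i :=
  Finset.sum_nonneg fun i _ => (hy i).1

lemma sum_le_of_mem_configs {n : ℕ} {y : Fin n → ℝ} (hy : y ∈ Configs n) : ∑ i, y i ≤ n := by
  calc ∑ i, y i ≤ ∑ _i : Fin n, (1 : ℝ) := Finset.sum_le_sum fun i _ => (hy i).2
    _ = n := by simp

lemma continuousOn_entropyMinusQuadratic {σ : ℝ} (hσ : 0 < σ) {n : ℕ} (x : Fin n → ℝ) :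
    ContinuousOn (entropyMinusQuadratic σ x) (Configs n) := by
  have h1 : Continuous (entropyTerm (n := n)) := by
    unfold entropyTerm
    refine continuous_finsetSum _ fun i _ => ?_
    exact (Real.continuous_mul_log.comp (continuous_apply i)).add
      (Real.continuous_mul_log.comp (continuous_const.sub (continuous_apply i)))
  refine h1.continuousOn.sub ?_
  unfold quadraticTerm
  refine ContinuousOn.div (by fun_prop) (by fun_prop) fun y hy => ?_
  have := sum_nonneg_of_mem_configs hy
  positivity

lemma continuousOn_freeEnergyGap {φ σ : ℝ} (hφ : 0 < φ) (hσ : 0 < σ) {n : ℕ} (x : Fin n → ℝ) :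
    ContinuousOn (freeEnergyGap φ σ x) (Configs n) := by
  have h : freeEnergyGap φ σ x = fun y =>
      entropyMinusQuadratic σ x y + mixingCost φ σ n (∑ i, y i) :=
    funext fun y => freeEnergyGap_eq φ σ x y
  rw [h]
  refine (continuousOn_entropyMinusQuadratic hσ x).add ?_
  have hc : ContinuousOn (mixingCost φ σ n) (Set.Icc 0 n) := by
    intro m hm
    have a1 : (0 : ℝ) < m + φ := by linarith [hm.1]
    have a2 : (0 : ℝ) < n - m + φ := by linarith [hm.2]
    have g1 := Real.Gamma_pos_of_pos (s := n + 2 * φ) (by positivity)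
    have g2 := Real.Gamma_pos_of_pos a2
    have g3 := Real.Gamma_pos_of_pos a1
    have c1 : ContinuousAt (fun m : ℝ => Real.Gamma (m + φ)) m :=
      ContinuousAt.comp (g := Real.Gamma)
        (differentiableAt_Gamma_of_pos a1).continuousAt (by fun_prop)
    have c2 : ContinuousAt (fun m : ℝ => Real.Gamma (n - m + φ)) m :=
      ContinuousAt.comp (g := Real.Gamma)
        (differentiableAt_Gamma_of_pos a2).continuousAt (by fun_prop)
    have d1 : Real.Gamma (n - m + φ) * Real.Gamma (m + φ) ≠ 0 := by positivity
    have d2 : Real.Gamma (n + 2 * φ) / (Real.Gamma (n - m + φ) * Real.Gamma (m + φ)) ≠ 0 := by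
      positivity
    have d3 : 1 + σ ^ 2 * m ≠ 0 := by have := hm.1; positivity
    unfold mixingCost
    apply ContinuousAt.continuousWithinAt
    fun_prop (disch := assumption)
  exact hc.comp (by fun_prop) fun y hy =>
    ⟨sum_nonneg_of_mem_configs hy, sum_le_of_mem_configs hy⟩

lemma isLeast_sInf_image {n : ℕ} {F : (Fin n → ℝ) → ℝ} {s : Set (Fin n → ℝ)}
    (hs : IsCompact s) (hne : s.Nonempty) (hF : ContinuousOn F s) :
    IsLeast (F '' s) (sInf (F '' s)) :=
  (hs.image_of_continuousOn hF).isLeast_sInf (hne.image F)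

lemma const_mem_configsWithSum {n : ℕ} {m : ℝ} (h0 : 0 ≤ m) (hn : m ≤ n) :
    (fun _ : Fin n => m / n) ∈ ConfigsWithSum n m := by
  rcases n.eq_zero_or_pos with rfl | hpos
  · have : m = 0 := le_antisymm (by simpa using hn) h0
    simp [ConfigsWithSum, Configs, this]
  · have : (0 : ℝ) < n := by positivity
    refine ⟨fun i => ⟨by positivity, (div_le_one this).2 hn⟩, ?_⟩
    simp; field_simp

lemma isLeast_minEntropyMinusQuadratic {σ : ℝ} (hσ : 0 < σ) {n : ℕ} (x : Fin n → ℝ) {m : ℝ}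
    (h0 : 0 ≤ m) (hn : m ≤ n) :
    IsLeast (entropyMinusQuadratic σ x '' ConfigsWithSum n m)
      (minEntropyMinusQuadratic σ x m) :=
  isLeast_sInf_image (isCompact_configsWithSum n m) ⟨_, const_mem_configsWithSum h0 hn⟩
    ((continuousOn_entropyMinusQuadratic hσ x).mono fun _ hy => hy.1)

lemma isLeast_minFreeEnergyGapWithSum {φ σ : ℝ} (hφ : 0 < φ) (hσ : 0 < σ) {n : ℕ}
    (x : Fin n → ℝ) {m : ℝ} (h0 : 0 ≤ m) (hn : m ≤ n) :
    IsLeast (freeEnergyGap φ σ x '' ConfigsWithSum n m)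
      (minFreeEnergyGapWithSum φ σ x m) :=
  isLeast_sInf_image (isCompact_configsWithSum n m) ⟨_, const_mem_configsWithSum h0 hn⟩
    ((continuousOn_freeEnergyGap hφ hσ x).mono fun _ hy => hy.1)

lemma isLeast_minFreeEnergyGap {φ σ : ℝ} (hφ : 0 < φ) (hσ : 0 < σ) {n : ℕ} (x : Fin n → ℝ) :
    IsLeast (freeEnergyGap φ σ x '' Configs n) (minFreeEnergyGap φ σ x) :=
  isLeast_sInf_image (isCompact_configs n) ⟨0, fun _ => by simp⟩
    (continuousOn_freeEnergyGap hφ hσ x)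

lemma minFreeEnergyGapWithSum_eq {φ σ : ℝ} (hφ : 0 < φ) (hσ : 0 < σ) {n : ℕ} (x : Fin n → ℝ)
    {m : ℝ} (h0 : 0 ≤ m) (hn : m ≤ n) :
    minFreeEnergyGapWithSum φ σ x m
      = minEntropyMinusQuadratic σ x m + mixingCost φ σ n m := by
  have h1 := isLeast_minEntropyMinusQuadratic hσ x h0 hn
  have h2 := isLeast_minFreeEnergyGapWithSum hφ hσ x h0 hn
  obtain ⟨y1, hy1, e1⟩ := h1.1
  obtain ⟨y2, hy2, e2⟩ := h2.1
  have l1 := h1.2 ⟨y2, hy2, rfl⟩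
  have l2 := h2.2 ⟨y1, hy1, rfl⟩
  rw [freeEnergyGap_eq, hy1.2] at l2
  rw [freeEnergyGap_eq, hy2.2] at e2
  linarith

/-! ### Gibbs variational bounds by the likelihood ratio. -/

/-- The log-likelihood ratio of the mixture `(1 - p) N(0,1) + p N(t,1)` against `N(0,1)`. -/
noncomputable def logLikelihood {n : ℕ} (p t : ℝ) (x : Fin n → ℝ) : ℝ :=
  ∑ i, Real.log (1 - p + p * Real.exp (t * x i - t ^ 2 / 2))

/-- This is `log z ≤ z - 1` at `z = a / (y Q)`, multiplied by `y`. -/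
lemma mul_log_gibbs {y a Q : ℝ} (hy : 0 ≤ y) (ha : 0 ≤ a) (hya : 0 < y → 0 < a) (hQ : 0 < Q) :
    y * Real.log a - y * Real.log Q - y * Real.log y ≤ a / Q - y := by
  rcases hy.eq_or_lt with rfl | h
  · simp; positivity
  · have ha := hya h
    have := Real.log_le_sub_one_of_pos (x := a / (y * Q)) (by positivity)
    rw [Real.log_div ha.ne' (by positivity), Real.log_mul h.ne' hQ.ne'] at this
    have h2 := mul_le_mul_of_nonneg_left this hy
    have : y * (a / (y * Q) - 1) = a / Q - y := by field_simp
    linarith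

/-- `mul_log_gibbs` for the weights `p exp τ` and `1 - p`, with `Q` their sum, so that the two
right-hand sides add up to zero. The endpoint `p = 1` needs its own hypothesis because `Real.log 0 =
0` instead of `-∞`. -/
lemma gibbs_binary {y p τ : ℝ} (hy0 : 0 ≤ y) (hy1 : y ≤ 1) (hp0 : 0 < p) (hp1 : p ≤ 1)
    (h : p = 1 → y = 1) :
    y * Real.log p + (1 - y) * Real.log (1 - p) - Real.log (1 - p + p * Real.exp τ)
      ≤ y * Real.log y + (1 - y) * Real.log (1 - y) - y * τ := by
  have hQ : 0 < 1 - p + p * Real.exp τ := by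
    have : 0 < p * Real.exp τ := by positivity
    linarith
  have h1 := mul_log_gibbs hy0 (a := p * Real.exp τ) (by positivity) (fun _ => by positivity) hQ
  have h2 := mul_log_gibbs (y := 1 - y) (by linarith) (a := 1 - p) (by linarith)
    (fun hy => by
      rcases hp1.eq_or_lt with e | e
      · linarith [h e]
      · linarith) hQ
  rw [Real.log_mul hp0.ne' (Real.exp_pos _).ne', Real.log_exp] at h1
  have : p * Real.exp τ / (1 - p + p * Real.exp τ) + (1 - p) / (1 - p + p * Real.exp τ) = 1 := by
    rw [← add_div, div_eq_one_iff_eq hQ.ne']; ring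
  linarith

lemma entropyMin_eq {n : ℕ} {m : ℝ} (hm : 0 < m) (hn : m ≤ n) :
    entropyMin n m = m * Real.log (m / n) + (n - m) * Real.log (1 - m / n) := by
  have hn0 : (0 : ℝ) < n := by linarith
  unfold entropyMin
  rw [Real.log_div hm.ne' hn0.ne']
  rcases hn.eq_or_lt with rfl | h
  · simp
  · have : 1 - m / n = (n - m) / n := by field_simp
    rw [this, Real.log_div (by linarith) hn0.ne']; ring

/-- The lower bound of `f` by the likelihood ratio at the maximizer of the quadratic term. -/
lemma exists_entropyMin_sub_logLikelihood_le {σ : ℝ} (hσ : 0 < σ) {n : ℕ} (x : Fin n → ℝ)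
    {y : Fin n → ℝ} {m : ℝ} (hm : 0 < m) (hy : y ∈ ConfigsWithSum n m) :
    ∃ t : ℝ, entropyMin n m - (logLikelihood (m / n) t x - t ^ 2 / (2 * σ ^ 2))
      ≤ entropyMinusQuadratic σ x y := by
  have hmn : m ≤ n := hy.2 ▸ sum_le_of_mem_configs hy.1
  have hn0 : (0 : ℝ) < n := by linarith
  set S := ∑ i, x i * y i with hS
  set A := m + 1 / σ ^ 2 with hA
  have hA0 : 0 < A := by positivity
  -- `S / A` maximizes `t S - t² A / 2`, and the maximum is the quadratic term.
  refine ⟨S / A, ?_⟩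
  set t := S / A with ht
  have hq : quadraticTerm σ x y = t * S - t ^ 2 * A / 2 := by
    unfold quadraticTerm
    rw [hy.2, ← hS, ← hA, ht]; field_simp; ring
  have hone : m / n = 1 → ∀ i, y i = 1 := by
    intro h i
    have hmn' : m = n := by field_simp at h; exact h
    have hz : ∑ j, (1 - y j) = 0 := by
      rw [Finset.sum_sub_distrib, hy.2, hmn']; simp
    have := (Finset.sum_eq_zero_iff_of_nonneg fun j _ => by linarith [(hy.1 j).2]).1 hz i
      (Finset.mem_univ i)
    linarith
  have key : ∀ i, _ := fun i => gibbs_binary (y := y i) (p := m / n)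
    (τ := t * x i - t ^ 2 / 2) (hy.1 i).1 (hy.1 i).2 (by positivity) ((div_le_one hn0).2 hmn)
    (fun h => hone h i)
  have hsum := Finset.sum_le_sum fun i (_ : i ∈ Finset.univ) => key i
  rw [Finset.sum_sub_distrib, Finset.sum_sub_distrib, Finset.sum_add_distrib, ← Finset.sum_mul,
    ← Finset.sum_mul, Finset.sum_sub_distrib, hy.2] at hsum
  have e1 : ∑ i, y i * (t * x i - t ^ 2 / 2) = t * S - t ^ 2 / 2 * m := by
    rw [hS, ← hy.2, Finset.mul_sum, Finset.mul_sum, ← Finset.sum_sub_distrib]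
    exact Finset.sum_congr rfl fun i _ => by ring
  rw [e1] at hsum
  simp only [Finset.sum_const, Finset.card_univ, Fintype.card_fin, nsmul_eq_mul, mul_one] at hsum
  unfold entropyMinusQuadratic entropyTerm logLikelihood
  rw [entropyMin_eq hm hmn, hq]
  -- The share `m` of `A` normalizes the tilts `t xᵢ - t²/2`; the share `1/σ²` survives as the
  -- Gaussian penalty.
  have e2 : t ^ 2 * A / 2 = t ^ 2 / 2 * m + t ^ 2 / (2 * σ ^ 2) := by
    rw [hA]; field_simp
  linarith

lemma quadraticTerm_nonneg {σ : ℝ} (hσ : 0 < σ) {n : ℕ} (x : Fin n → ℝ) {y : Fin n → ℝ}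
    (hy : y ∈ Configs n) : 0 ≤ quadraticTerm σ x y := by
  have := sum_nonneg_of_mem_configs hy
  unfold quadraticTerm
  positivity

lemma entropyMinusQuadratic_const_le {σ : ℝ} (hσ : 0 < σ) {n : ℕ} (x : Fin n → ℝ) {m : ℝ}
    (hm : 0 < m) (hn : m ≤ n) :
    entropyMinusQuadratic σ x (fun _ => m / n) ≤ entropyMin n m := by
  have hn0 : (0 : ℝ) < n := by linarith
  have := quadraticTerm_nonneg hσ x (const_mem_configsWithSum hm.le hn).1
  have e : entropyTerm (fun _ : Fin n => m / n) = entropyMin n m := by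
    rw [entropyMin_eq hm hn]
    simp only [entropyTerm, Finset.sum_const, Finset.card_univ, Fintype.card_fin, nsmul_eq_mul]
    field_simp
  unfold entropyMinusQuadratic
  linarith

lemma minEntropyMinusQuadratic_le {σ : ℝ} (hσ : 0 < σ) {n : ℕ} (x : Fin n → ℝ) {m : ℝ}
    (hm : 0 < m) (hn : m ≤ n) : minEntropyMinusQuadratic σ x m ≤ entropyMin n m :=
  ((isLeast_minEntropyMinusQuadratic hσ x hm.le hn).2
    ⟨_, const_mem_configsWithSum hm.le hn, rfl⟩).trans (entropyMinusQuadratic_const_le hσ x hm hn)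

lemma minFreeEnergyGap_le {φ σ : ℝ} (hφ : 0 < φ) (hσ : 0 < σ) {n : ℕ} (x : Fin n → ℝ) {m : ℝ}
    (hm : 0 < m) (hn : m ≤ n) :
    minFreeEnergyGap φ σ x ≤ entropyMin n m + mixingCost φ σ n m := by
  have hc := const_mem_configsWithSum hm.le hn
  refine ((isLeast_minFreeEnergyGap hφ hσ x).2 ⟨_, hc.1, rfl⟩).trans ?_
  rw [freeEnergyGap_eq, hc.2]
  linarith [entropyMinusQuadratic_const_le hσ x hm hn]

/-- Bernoulli's inequality for the likelihood ratio, as a function of the mixing ratio. -/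
lemma logLikelihood_mul_le {n : ℕ} {p θ t : ℝ} (x : Fin n → ℝ) (hp0 : 0 ≤ p) (hp1 : p < 1)
    (hθ : 1 ≤ θ) (hp : θ * p ≤ 1) :
    logLikelihood (θ * p) t x ≤ θ * logLikelihood p t x := by
  unfold logLikelihood
  rw [Finset.mul_sum]
  refine Finset.sum_le_sum fun i _ => ?_
  set u := Real.exp (t * x i - t ^ 2 / 2)
  have hu : 0 < u := Real.exp_pos _
  have h1 : 0 < 1 - p + p * u := by nlinarith [mul_nonneg hp0 hu.le]
  rw [← Real.log_rpow h1]
  have hθp : 0 ≤ θ * p := by positivity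
  have hpos : 0 < 1 - θ * p + θ * p * u := by
    rcases hθp.eq_or_lt with h | h
    · rw [← h]; simp
    · have := mul_pos h hu; linarith
  refine Real.log_le_log hpos ?_
  have := one_add_mul_self_le_rpow_one_add (s := p * (u - 1)) (by nlinarith [mul_nonneg hp0 hu.le])
    hθ
  have e : 1 + p * (u - 1) = 1 - p + p * u := by ring
  rw [e] at this
  linarith

/-! ### Gaussian tilts, integration by parts, Cauchy–Schwarz. -/

/-- The standard Gaussian law on the line. -/
noncomputable abbrev gaussianStd : Measure ℝ := gaussianReal 0 1

/-- The likelihood ratio of `N(t, 1)` against `N(0, 1)`. -/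
noncomputable def tilt (t x : ℝ) : ℝ := Real.exp (t * x - t ^ 2 / 2)

lemma tilt_pos (t x : ℝ) : 0 < tilt t x := Real.exp_pos _

@[fun_prop]
lemma continuous_tilt (t : ℝ) : Continuous (tilt t) := by unfold tilt; fun_prop

lemma hasDerivAt_tilt (t x : ℝ) : HasDerivAt (tilt t) (t * tilt t x) x := by
  have h : HasDerivAt (fun x => t * x - t ^ 2 / 2) t x := by
    simpa using ((hasDerivAt_id x).const_mul t).sub_const (t ^ 2 / 2)
  have h' := h.exp
  rw [mul_comm] at h'
  exact h'

lemma integrable_pow_mul_exp_gaussianStd (k : ℕ) (a : ℝ) :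
    Integrable (fun x => x ^ k * Real.exp (a * x)) gaussianStd :=
  integrable_pow_mul_exp_of_mem_interior_integrableExpSet (X := fun x => x) (by simp) k

lemma integrable_sub_pow_mul_pow_mul_exp (t a : ℝ) (k : ℕ) : ∀ l : ℕ,
    Integrable (fun x => (x - t) ^ k * (x ^ l * Real.exp (a * x))) gaussianStd := by
  induction k with
  | zero => intro l; simpa using integrable_pow_mul_exp_gaussianStd l a
  | succ k ih =>
    intro l
    refine ((ih (l + 1)).sub ((ih l).const_mul t)).congr (ae_of_all _ fun x => ?_)
    simp only [Pi.sub_apply]; ring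

lemma integrable_sub_pow_mul_tilt_pow (t : ℝ) (k j : ℕ) :
    Integrable (fun x => (x - t) ^ k * tilt t x ^ j) gaussianStd := by
  refine ((integrable_sub_pow_mul_pow_mul_exp t (j * t) k 0).mul_const
    (Real.exp (-(j * (t ^ 2 / 2))))).congr (ae_of_all _ fun x => ?_)
  simp only [tilt, pow_zero, one_mul]
  rw [← Real.exp_nat_mul, mul_assoc, ← Real.exp_add]
  congr 2; ring

lemma integrable_tilt_pow (t : ℝ) (j : ℕ) :
    Integrable (fun x => tilt t x ^ j) gaussianStd := by
  simpa using integrable_sub_pow_mul_tilt_pow t 0 j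

lemma integrable_tilt (t : ℝ) : Integrable (tilt t) gaussianStd := by
  simpa using integrable_tilt_pow t 1

lemma integral_exp_mul_gaussianStd (a : ℝ) :
    ∫ x, Real.exp (a * x) ∂gaussianStd = Real.exp (a ^ 2 / 2) := by
  have := congrFun (mgf_id_gaussianReal (μ := 0) (v := 1)) a
  simpa [mgf] using this

lemma integral_tilt (t : ℝ) : ∫ x, tilt t x ∂gaussianStd = 1 := by
  have : ∀ x, tilt t x = Real.exp (t * x) * Real.exp (-(t ^ 2 / 2)) := fun x => by
    rw [tilt, ← Real.exp_add, sub_eq_add_neg]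
  simp_rw [this]
  rw [integral_mul_const, integral_exp_mul_gaussianStd, ← Real.exp_add, add_neg_cancel,
    Real.exp_zero]

lemma integral_tilt_sq (t : ℝ) : ∫ x, tilt t x ^ 2 ∂gaussianStd = Real.exp (t ^ 2) := by
  have : ∀ x, tilt t x ^ 2 = Real.exp (2 * t * x) * Real.exp (-t ^ 2) := fun x => by
    rw [tilt, ← Real.exp_nat_mul, ← Real.exp_add]; congr 1; push_cast; ring
  simp_rw [this]
  rw [integral_mul_const, integral_exp_mul_gaussianStd, ← Real.exp_add]
  congr 1; ring

/-- Gaussian integration by parts. -/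
lemma integral_deriv_eq_integral_mul_gaussianStd {F F' : ℝ → ℝ}
    (hF : ∀ x, HasDerivAt F (F' x) x) (h0 : Integrable F gaussianStd)
    (h1 : Integrable F' gaussianStd) (h2 : Integrable (fun x => x * F x) gaussianStd) :
    ∫ x, F' x ∂gaussianStd = ∫ x, x * F x ∂gaussianStd := by
  have hv : (1 : NNReal) ≠ 0 := one_ne_zero
  have hint : ∀ {f : ℝ → ℝ}, Integrable f gaussianStd →
      Integrable (fun x => gaussianPDFReal 0 1 x * f x) := by
    intro f hf
    rw [gaussianStd, gaussianReal_of_var_ne_zero 0 hv,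
      integrable_withDensity_iff_integrable_smul' (measurable_gaussianPDF 0 1)
      (ae_of_all _ fun _ => gaussianPDF_lt_top)] at hf
    simpa [toReal_gaussianPDF] using hf
  have hpdf : ∀ x, HasDerivAt (gaussianPDFReal 0 1) (-x * gaussianPDFReal 0 1 x) x := by
    intro x
    have h : HasDerivAt (fun x : ℝ => -(x - 0) ^ 2 / (2 * ((1 : NNReal) : ℝ))) (-x) x := by
      have := (((hasDerivAt_id' x).sub_const 0).fun_pow 2).fun_neg.div_const
        (2 * ((1 : NNReal) : ℝ))
      refine this.congr_deriv ?_
      simp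
      ring
    have := h.exp.const_mul ((√(2 * Real.pi * ((1 : NNReal) : ℝ)))⁻¹)
    simp only [gaussianPDFReal_def]
    refine this.congr_deriv ?_
    ring
  have hd : ∀ x, HasDerivAt (fun x => gaussianPDFReal 0 1 x * F x)
      (gaussianPDFReal 0 1 x * (F' x - x * F x)) x := fun x => by
    refine ((hpdf x).fun_mul (hF x)).congr_deriv ?_
    ring
  -- The derivative of density times `F` is the density times `F' - x F`; it integrates to zero over
  -- the line.
  have := integral_eq_zero_of_hasDerivAt_of_integrable hd (hint (h1.sub h2)) (hint h0)
  have e := integral_gaussianReal_eq_integral_smul (μ := 0) hv (f := fun x => F' x - x * F x)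
  simp only [smul_eq_mul] at e
  rw [this, integral_sub h1 h2] at e
  exact sub_eq_zero.1 e

lemma integral_sub_mul_tilt (t : ℝ) : ∫ x, (x - t) * tilt t x ∂gaussianStd = 0 := by
  have h1 : Integrable (fun x => (x - t) * tilt t x) gaussianStd := by
    simpa using integrable_sub_pow_mul_tilt_pow t 1 1
  have h2 : Integrable (fun x => x * tilt t x) gaussianStd :=
    (h1.add ((integrable_tilt t).const_mul t)).congr (ae_of_all _ fun x => by
      simp only [Pi.add_apply]; ring)
  have := integral_deriv_eq_integral_mul_gaussianStd (hasDerivAt_tilt t) (integrable_tilt t)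
    ((integrable_tilt t).const_mul t) h2
  simp_rw [sub_mul]
  rw [integral_sub h2 ((integrable_tilt t).const_mul t), this, sub_self]

/-- The Cauchy–Schwarz inequality, with the pointwise inequality `h ^ 2 ≤ F * G` as hypothesis. -/
lemma sq_integral_le_integral_mul_integral {α : Type*} [MeasurableSpace α] {ν : Measure α}
    {h F G : α → ℝ} (hh : Integrable h ν) (hF : Integrable F ν) (hG : Integrable G ν)
    (hF0 : ∀ x, 0 ≤ F x) (hG0 : ∀ x, 0 ≤ G x) (hle : ∀ x, h x ^ 2 ≤ F x * G x) :
    (∫ x, h x ∂ν) ^ 2 ≤ (∫ x, F x ∂ν) * ∫ x, G x ∂ν := by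
  -- The integrand `F s² + 2 h s + G` is nonnegative pointwise, so the discriminant of its integral
  -- is nonpositive.
  have key : ∀ s : ℝ, 0 ≤ (∫ x, F x ∂ν) * (s * s) + 2 * (∫ x, h x ∂ν) * s + ∫ x, G x ∂ν := by
    intro s
    have hp : ∀ x, 0 ≤ F x * (s * s) + 2 * h x * s + G x := by
      intro x
      rcases (hF0 x).eq_or_lt with h0 | h0
      · have h1 := hle x
        rw [← h0, zero_mul] at h1
        have : h x = 0 := by nlinarith
        rw [← h0, this]; simpa using hG0 x
      · refine nonneg_of_mul_nonneg_right (a := F x) ?_ h0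
        nlinarith [sq_nonneg (F x * s + h x), hle x]
    have := integral_nonneg (μ := ν) (f := fun x => F x * (s * s) + 2 * h x * s + G x) hp
    have e1 : Integrable (fun x => F x * (s * s)) ν := hF.mul_const _
    have e2 : Integrable (fun x => 2 * h x * s) ν := (hh.const_mul 2).mul_const s
    have e3 : Integrable (fun x => F x * (s * s) + 2 * h x * s) ν := e1.add e2
    rwa [integral_add e3 hG, integral_add e1 e2, integral_mul_const, integral_mul_const,
      integral_const_mul] at this
  have := discrim_le_zero key
  unfold discrim at this
  linarith

/-! ### Fisher information and Hellinger distance of one observation. -/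

/-- The density of the mixture with ratio `p`. -/
noncomputable def mixDensity (p t x : ℝ) : ℝ := 1 - p + p * tilt t x

/-- The derivative of `log (mixDensity p t x)` in `t`. -/
noncomputable def mixScore (p t x : ℝ) : ℝ := p * (x - t) * tilt t x / mixDensity p t x

/-- The Hellinger affinity between the mixture and the standard Gaussian law. -/
noncomputable def affinity (p t : ℝ) : ℝ := ∫ x, √(mixDensity p t x) ∂gaussianStd

/-- An upper bound for the Fisher information of the mixture, up to the factor `p ^ 2`. -/
noncomputable def fisherWeight (p t : ℝ) : ℝ :=
  ∫ x, (x - t) ^ 2 * tilt t x ^ 2 / (1 + p * tilt t x) ∂gaussianStd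

/-- A lower bound for the squared Hellinger distance, up to the factor `p ^ 2`. -/
noncomputable def hellingerWeight (p t : ℝ) : ℝ :=
  ∫ x, (tilt t x - 1) ^ 2 / (1 + p * tilt t x) ∂gaussianStd

section
variable {p : ℝ} (t : ℝ)

lemma one_le_one_add_mul_tilt (hp : 0 ≤ p) (x : ℝ) : 1 ≤ 1 + p * tilt t x := by
  have := mul_nonneg hp (tilt_pos t x).le
  linarith

lemma integrable_div_one_add (hp : 0 ≤ p) {f : ℝ → ℝ} (hf : Integrable f gaussianStd) :
    Integrable (fun x => f x / (1 + p * tilt t x)) gaussianStd := by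
  have hm : Measurable fun x => 1 + p * tilt t x := by
    have := (continuous_tilt t).measurable
    fun_prop
  refine hf.norm.mono' (hf.aestronglyMeasurable.div₀ hm.aestronglyMeasurable) (ae_of_all _ fun x => ?_)
  have h := one_le_one_add_mul_tilt t hp x
  rw [norm_div, Real.norm_eq_abs (1 + p * tilt t x), abs_of_nonneg (by linarith)]
  exact div_le_self (norm_nonneg _) h

lemma integrable_tilt_sub_one_sq : Integrable (fun x => (tilt t x - 1) ^ 2) gaussianStd := by
  refine (((integrable_tilt_pow t 2).sub ((integrable_tilt t).const_mul 2)).add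
    (integrable_const 1)).congr (ae_of_all _ fun x => ?_)
  simp only [Pi.add_apply, Pi.sub_apply]; ring

lemma fisherWeight_nonneg (hp : 0 ≤ p) : 0 ≤ fisherWeight p t :=
  integral_nonneg fun x => div_nonneg (by positivity) (by linarith [one_le_one_add_mul_tilt t hp x])

lemma hellingerWeight_nonneg (hp : 0 ≤ p) : 0 ≤ hellingerWeight p t :=
  integral_nonneg fun x => div_nonneg (by positivity) (by linarith [one_le_one_add_mul_tilt t hp x])

/-- With `φ = u²/(1 + p u)` and `u` the tilt, `φ' = t φ (1 + 1/(1 + p u))`. Integrating `(x - t) φ`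
by parts leaves `∫ (x-t)² φ = ∫ φ + ∫ t (x-t) φ/(1 + p u)`, and half of the left side absorbs the
last integral. -/
lemma fisherWeight_le (hp : 0 ≤ p) : fisherWeight p t
    ≤ (2 + t ^ 2) * ∫ x, tilt t x ^ 2 / (1 + p * tilt t x) ∂gaussianStd := by
  set φ : ℝ → ℝ := fun x => tilt t x ^ 2 / (1 + p * tilt t x) with hφ
  have hpos : ∀ x, 0 < 1 + p * tilt t x := fun x => by
    linarith [one_le_one_add_mul_tilt t hp x]
  have i0 : Integrable φ gaussianStd := integrable_div_one_add t hp (integrable_tilt_pow t 2)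
  have i1 : Integrable (fun x => (x - t) * φ x) gaussianStd := by
    refine (integrable_div_one_add t hp (integrable_sub_pow_mul_tilt_pow t 1 2)).congr
      (ae_of_all _ fun x => ?_)
    simp only [hφ]; ring
  have i2 : Integrable (fun x => (x - t) ^ 2 * φ x) gaussianStd := by
    refine (integrable_div_one_add t hp (integrable_sub_pow_mul_tilt_pow t 2 2)).congr
      (ae_of_all _ fun x => ?_)
    simp only [hφ]; ring
  have i3 : Integrable (fun x => t * ((x - t) * φ x / (1 + p * tilt t x))) gaussianStd :=
    (integrable_div_one_add t hp i1).const_mul t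
  have hd : ∀ x, HasDerivAt (fun x => (x - t) * φ x)
      (φ x + (t * ((x - t) * φ x) + t * ((x - t) * φ x / (1 + p * tilt t x)))) x := by
    intro x
    have h1 := ((hasDerivAt_tilt t x).pow 2).div
      (((hasDerivAt_tilt t x).const_mul p).const_add 1) (hpos x).ne'
    have h2 := ((hasDerivAt_id x).sub_const t).mul h1
    refine h2.congr_deriv ?_
    have := (hpos x).ne'
    simp only [hφ, id, Pi.pow_apply, Pi.div_apply]
    field_simp
    ring
  have i4 : Integrable (fun x => x * ((x - t) * φ x)) gaussianStd :=
    (i2.add (i1.const_mul t)).congr (ae_of_all _ fun x => by simp only [Pi.add_apply]; ring)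
  have i5 : Integrable (fun x => t * ((x - t) * φ x)
      + t * ((x - t) * φ x / (1 + p * tilt t x))) gaussianStd := (i1.const_mul t).add i3
  have ibp := integral_deriv_eq_integral_mul_gaussianStd hd i1
    (i0.add i5) i4
  have e4 : ∫ x, x * ((x - t) * φ x) ∂gaussianStd
      = (∫ x, (x - t) ^ 2 * φ x ∂gaussianStd) + ∫ x, t * ((x - t) * φ x) ∂gaussianStd := by
    rw [← integral_add i2 (i1.const_mul t)]
    exact integral_congr_ae (ae_of_all _ fun x => by ring)
  rw [integral_add i0 i5, integral_add (i1.const_mul t) i3, e4] at ibp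
  have hle : ∫ x, t * ((x - t) * φ x / (1 + p * tilt t x)) ∂gaussianStd
      ≤ ∫ x, (1 / 2 * ((x - t) ^ 2 * φ x) + t ^ 2 / 2 * φ x) ∂gaussianStd := by
    refine integral_mono i3 ((i2.const_mul _).add (i0.const_mul _)) fun x => ?_
    have hφ0 : 0 ≤ φ x := div_nonneg (by positivity) (hpos x).le
    have h1 := one_le_one_add_mul_tilt t hp x
    calc t * ((x - t) * φ x / (1 + p * tilt t x))
        ≤ |t * ((x - t) * φ x / (1 + p * tilt t x))| := le_abs_self _
      _ = |t * ((x - t) * φ x)| / (1 + p * tilt t x) := by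
        rw [← mul_div_assoc, abs_div, abs_of_pos (hpos x)]
      _ ≤ |t * ((x - t) * φ x)| := div_le_self (abs_nonneg _) h1
      _ = |t * (x - t)| * φ x := by rw [← mul_assoc, abs_mul, abs_of_nonneg hφ0]
      _ ≤ (1 / 2 * (x - t) ^ 2 + t ^ 2 / 2) * φ x := by
        gcongr
        rw [abs_le]
        constructor <;> nlinarith [sq_nonneg (t + (x - t)), sq_nonneg (t - (x - t))]
      _ = _ := by ring
  rw [integral_add (i2.const_mul _) (i0.const_mul _)] at hle
  simp only [integral_const_mul] at hle ibp
  have eA : fisherWeight p t = ∫ x, (x - t) ^ 2 * φ x ∂gaussianStd :=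
    integral_congr_ae (ae_of_all _ fun x => by simp only [hφ]; ring)
  rw [eA]
  linarith

/-- Pointwise, `u² ≤ 2 (u - 1)² + 2`. A large Fisher weight thus forces a large Hellinger weight up
to the factor `2 + t²`. -/
lemma integral_tilt_sq_div_le (hp : 0 ≤ p) :
    ∫ x, tilt t x ^ 2 / (1 + p * tilt t x) ∂gaussianStd ≤ 2 * hellingerWeight p t + 2 := by
  have i1 := integrable_div_one_add t hp (integrable_tilt_sub_one_sq t)
  have : (2 * hellingerWeight p t + 2)
      = ∫ x, (2 * ((tilt t x - 1) ^ 2 / (1 + p * tilt t x)) + 2) ∂gaussianStd := by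
    rw [integral_add (i1.const_mul 2) (integrable_const _), integral_const_mul]
    simp [hellingerWeight]
  rw [this]
  refine integral_mono (integrable_div_one_add t hp (integrable_tilt_pow t 2))
    ((i1.const_mul 2).add (integrable_const _)) fun x => ?_
  have h := one_le_one_add_mul_tilt t hp x
  have h0 : 0 < 1 + p * tilt t x := by linarith
  beta_reduce
  rw [div_le_iff₀ h0, add_mul, ← mul_div_assoc, div_mul_cancel₀ _ h0.ne']
  nlinarith [sq_nonneg (tilt t x - 2)]

lemma integral_tilt_sq_div_le_exp (hp : 0 ≤ p) :
    ∫ x, tilt t x ^ 2 / (1 + p * tilt t x) ∂gaussianStd ≤ Real.exp (t ^ 2) := by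
  rw [← integral_tilt_sq]
  exact integral_mono (integrable_div_one_add t hp (integrable_tilt_pow t 2))
    (integrable_tilt_pow t 2) fun x => div_le_self (by positivity) (one_le_one_add_mul_tilt t hp x)

lemma hellingerWeight_le (hp : 0 ≤ p) : hellingerWeight p t ≤ Real.exp (t ^ 2) - 1 := by
  have e : ∫ x, (tilt t x - 1) ^ 2 ∂gaussianStd = Real.exp (t ^ 2) - 1 := by
    have : ∀ x, (tilt t x - 1) ^ 2 = tilt t x ^ 2 - 2 * tilt t x + 1 := fun x => by ring
    have i1 : Integrable (fun x => tilt t x ^ 2 - 2 * tilt t x) gaussianStd :=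
      (integrable_tilt_pow t 2).sub ((integrable_tilt t).const_mul 2)
    simp_rw [this]
    rw [integral_add i1 (integrable_const _), integral_sub (integrable_tilt_pow t 2)
      ((integrable_tilt t).const_mul 2), integral_const_mul, integral_tilt_sq, integral_tilt]
    simp; ring
  rw [← e]
  exact integral_mono (integrable_div_one_add t hp (integrable_tilt_sub_one_sq t))
    (integrable_tilt_sub_one_sq t)
    fun x => div_le_self (by positivity) (one_le_one_add_mul_tilt t hp x)

/-- Imaginary part of the complex moment generating function at `t + i w`. -/
lemma integral_tilt_mul_sin (w : ℝ) :
    ∫ x, tilt t x * Real.sin (w * x) ∂gaussianStd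
      = Real.sin (w * t) * Real.exp (-(w ^ 2 / 2)) := by
  have h := complexMGF_id_gaussianReal (μ := 0) (v := 1) (t + w * Complex.I)
  have hint : Integrable (fun x : ℝ => Complex.exp ((t + w * Complex.I) * x)) gaussianStd := by
    refine (integrable_exp_mul_gaussianReal (μ := 0) (v := 1) t).mono' (by fun_prop)
      (ae_of_all _ fun x => ?_)
    rw [Complex.norm_exp]
    simp
  have him : ∫ x : ℝ, Real.exp (t * x) * Real.sin (w * x) ∂gaussianStd
      = Real.exp ((t ^ 2 - w ^ 2) / 2) * Real.sin (w * t) := by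
    have h2 := congrArg Complex.im h
    rw [complexMGF] at h2
    have e := integral_im (𝕜 := ℂ) hint
    simp only [RCLike.im_to_complex, id] at e h2
    rw [← e] at h2
    simp only [Complex.exp_im] at h2
    simp [pow_two] at h2
    rw [h2]
    congr 2 <;> ring
  have : ∀ x, tilt t x * Real.sin (w * x)
      = Real.exp (-(t ^ 2 / 2)) * (Real.exp (t * x) * Real.sin (w * x)) := fun x => by
    rw [tilt, sub_eq_add_neg, Real.exp_add]; ring
  simp_rw [this]
  rw [integral_const_mul, him, ← mul_assoc, ← Real.exp_add, mul_comm]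
  congr 2; ring

/-- The bounded test function `sin (w x)` separates `N(t,1)` from `N(0,1)`. Cauchy–Schwarz against
the weight `1 + p u`, whose mean is `1 + p ≤ 3/2`, gives a bound uniform in `p`. -/
lemma le_hellingerWeight_of_frequency (hp : 0 ≤ p) (hp' : p ≤ 1 / 2) (w : ℝ) :
    Real.sin (w * t) ^ 2 * Real.exp (-w ^ 2) ≤ 3 / 2 * hellingerWeight p t := by
  have i1 : Integrable (fun x => tilt t x * Real.sin (w * x)) gaussianStd :=
    (integrable_tilt t).mul_bdd (c := 1) (by fun_prop)
      (ae_of_all _ fun x => by simpa using Real.abs_sin_le_one _)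
  have i2 : Integrable (fun x => Real.sin (w * x)) gaussianStd :=
    (integrable_const (1 : ℝ)).mono' (by fun_prop)
      (ae_of_all _ fun x => by simpa using Real.abs_sin_le_one _)
  have e2 : ∫ x, Real.sin (w * x) ∂gaussianStd = 0 := by
    have := integral_tilt_mul_sin 0 w
    simpa [tilt] using this
  have i3 : Integrable (fun x => 1 + p * tilt t x) gaussianStd :=
    (integrable_const 1).add ((integrable_tilt t).const_mul p)
  have e3 : ∫ x, (1 + p * tilt t x) ∂gaussianStd = 1 + p := by
    rw [integral_add (integrable_const 1) ((integrable_tilt t).const_mul p), integral_const_mul,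
      integral_tilt]
    simp
  have cs := sq_integral_le_integral_mul_integral (ν := gaussianStd)
    (h := fun x => tilt t x * Real.sin (w * x) - Real.sin (w * x))
    (i1.sub i2) (integrable_div_one_add t hp (integrable_tilt_sub_one_sq t)) i3
    (fun x => div_nonneg (by positivity) (by linarith [one_le_one_add_mul_tilt t hp x]))
    (fun x => by linarith [one_le_one_add_mul_tilt t hp x])
    (fun x => by
      have h := one_le_one_add_mul_tilt t hp x
      rw [div_mul_cancel₀ _ (by linarith)]
      have : tilt t x * Real.sin (w * x) - Real.sin (w * x)
        = (tilt t x - 1) * Real.sin (w * x) := by ring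
      rw [this, mul_pow]
      exact mul_le_of_le_one_right (by positivity) (Real.sin_sq_le_one _))
  rw [integral_sub i1 i2, e2, sub_zero, integral_tilt_mul_sin, e3, mul_pow,
    ← Real.exp_nat_mul] at cs
  have hB := hellingerWeight_nonneg t hp
  have e5 : ((2 : ℕ) : ℝ) * -(w ^ 2 / 2) = -w ^ 2 := by push_cast; ring
  rw [e5] at cs
  refine cs.trans ?_
  change hellingerWeight p t * _ ≤ _
  nlinarith

lemma sq_div_four_le_sin_sq {x : ℝ} (hx : |x| ≤ 1) : x ^ 2 / 4 ≤ Real.sin x ^ 2 := by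
  have key : ∀ y : ℝ, 0 ≤ y → y ≤ 1 → y ^ 2 / 4 ≤ Real.sin y ^ 2 := by
    intro y h0 h1
    have hpi := Real.pi_gt_three
    have hpi' := Real.pi_le_four
    have h := Real.mul_le_sin h0 (by linarith)
    have : y / 2 ≤ 2 / Real.pi * y := by
      have : (1 : ℝ) / 2 ≤ 2 / Real.pi := by
        rw [div_le_div_iff₀ (by norm_num) (by linarith)]; linarith
      nlinarith
    nlinarith
  rcases abs_le.1 hx with ⟨h1, h2⟩
  rcases le_total 0 x with h | h
  · exact key x h h2
  · have := key (-x) (by linarith) (by linarith)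
    simpa using this

lemma one_third_le_exp_neg_sq {w : ℝ} (hw : w ^ 2 ≤ 1) : 1 / 3 ≤ Real.exp (-w ^ 2) := by
  have h1 : Real.exp (-1) ≤ Real.exp (-w ^ 2) := Real.exp_le_exp.2 (by linarith)
  have h2 := Real.exp_one_lt_d9
  have h3 : 1 / 3 ≤ Real.exp (-1) := by
    rw [Real.exp_neg, ← one_div]
    exact one_div_le_one_div_of_le (Real.exp_pos _) (by linarith)
  linarith

/-- Frequency `w = 1`; the loss is quadratic in `t` near the null. -/
lemma sq_le_hellingerWeight (hp : 0 ≤ p) (hp' : p ≤ 1 / 2) (ht : |t| ≤ 1) :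
    t ^ 2 / 18 ≤ hellingerWeight p t := by
  have h := le_hellingerWeight_of_frequency t hp hp' 1
  rw [one_mul] at h
  have h1 := sq_div_four_le_sin_sq ht
  have h2 := one_third_le_exp_neg_sq (w := 1) (by norm_num)
  have : t ^ 2 / 4 * (1 / 3) ≤ Real.sin t ^ 2 * Real.exp (-1 ^ 2) := by gcongr
  linarith

/-- Frequency `w = 1/t`, so that `w t = 1` and the Gaussian damping `exp (-w²)` stays bounded below.
-/
lemma one_le_hellingerWeight (hp : 0 ≤ p) (hp' : p ≤ 1 / 2) (ht : 1 ≤ |t|) :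
    1 / 18 ≤ hellingerWeight p t := by
  have ht0 : t ≠ 0 := by rintro rfl; norm_num at ht
  have h := le_hellingerWeight_of_frequency t hp hp' (1 / t)
  rw [one_div_mul_cancel ht0] at h
  have h1 := sq_div_four_le_sin_sq (x := 1) (by norm_num)
  have h2 := one_third_le_exp_neg_sq (w := 1 / t) (by
    rw [div_pow, one_pow]
    have : 1 ≤ t ^ 2 := by rw [← sq_abs]; nlinarith
    exact (div_le_one (by positivity)).2 this)
  have : (1 : ℝ) ^ 2 / 4 * (1 / 3) ≤ Real.sin 1 ^ 2 * Real.exp (-(1 / t) ^ 2) := by gcongr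
  linarith

lemma mixDensity_ge (hp : 0 ≤ p) (hp' : p ≤ 1 / 2) (x : ℝ) :
    (1 + p * tilt t x) / 2 ≤ mixDensity p t x ∧ 1 / 2 ≤ mixDensity p t x := by
  have := mul_nonneg hp (tilt_pos t x).le
  unfold mixDensity
  constructor <;> linarith

lemma mixDensity_pos (hp : 0 ≤ p) (hp' : p ≤ 1 / 2) (x : ℝ) : 0 < mixDensity p t x := by
  linarith [(mixDensity_ge t hp hp' x).2]

@[fun_prop]
lemma continuous_mixDensity : Continuous (mixDensity p t) := by unfold mixDensity; fun_prop

lemma continuous_mixScore (hp : 0 ≤ p) (hp' : p ≤ 1 / 2) : Continuous (mixScore p t) := by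
  unfold mixScore
  exact Continuous.div (by fun_prop) (by fun_prop) fun x => (mixDensity_pos t hp hp' x).ne'

lemma integrable_mixDensity : Integrable (mixDensity p t) gaussianStd :=
  (integrable_const (1 - p)).add ((integrable_tilt t).const_mul p)

lemma integral_mixDensity : ∫ x, mixDensity p t x ∂gaussianStd = 1 := by
  unfold mixDensity
  rw [integral_add (integrable_const (1 - p)) ((integrable_tilt t).const_mul p),
    integral_const_mul, integral_tilt]
  simp

lemma sqrt_mixDensity_ge (hp : 0 ≤ p) (hp' : p ≤ 1 / 2) (x : ℝ) : 2 / 3 ≤ √(mixDensity p t x) :=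
  Real.le_sqrt_of_sq_le (by linarith [(mixDensity_ge t hp hp' x).2])

lemma integrable_sqrt_mixDensity (hp : 0 ≤ p) (hp' : p ≤ 1 / 2) :
    Integrable (fun x => √(mixDensity p t x)) gaussianStd := by
  refine ((integrable_const (1 : ℝ)).add (integrable_mixDensity t (p := p))).mono'
    (by fun_prop) (ae_of_all _ fun x => ?_)
  have h := Real.sq_sqrt (mixDensity_pos t hp hp' x).le
  rw [Real.norm_eq_abs, abs_of_nonneg (Real.sqrt_nonneg _)]
  simp only [Pi.add_apply]
  nlinarith [sq_nonneg (√(mixDensity p t x) - 1)]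

lemma two_thirds_le_affinity (hp : 0 ≤ p) (hp' : p ≤ 1 / 2) : 2 / 3 ≤ affinity p t := by
  have : (2 / 3 : ℝ) = ∫ _x, (2 / 3 : ℝ) ∂gaussianStd := by simp
  rw [this]
  exact integral_mono (integrable_const _) (integrable_sqrt_mixDensity t hp hp')
    fun x => sqrt_mixDensity_ge t hp hp' x

/-- Write `√q = (1 + q)/2 - (√q - 1)²/2` with `∫ q = 1`, and `√q - 1 = p (u - 1)/(√q + 1)` with `(√q
+ 1)² ≤ 4 (1 + p u)`. -/
lemma affinity_le (hp : 0 ≤ p) (hp' : p ≤ 1 / 2) :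
    affinity p t ≤ 1 - p ^ 2 * hellingerWeight p t / 8 := by
  have i1 := integrable_div_one_add t hp (integrable_tilt_sub_one_sq t)
  have i2 := integrable_sqrt_mixDensity t hp hp'
  have i3 := integrable_mixDensity t (p := p)
  have i4 : Integrable (fun x => 1 / 2 * mixDensity p t x + 1 / 2) gaussianStd :=
    (i3.const_mul _).add (integrable_const _)
  have key : ∫ x, √(mixDensity p t x) ∂gaussianStd ≤ ∫ x, (1 / 2 * mixDensity p t x + 1 / 2
      - p ^ 2 / 8 * ((tilt t x - 1) ^ 2 / (1 + p * tilt t x))) ∂gaussianStd := by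
    refine integral_mono i2 (i4.sub (i1.const_mul _))
      fun x => ?_
    have hq := (mixDensity_pos t hp hp' x)
    have hu := mul_nonneg hp (tilt_pos t x).le
    have hs := Real.sq_sqrt hq.le
    have hr := Real.sqrt_nonneg (mixDensity p t x)
    set r := √(mixDensity p t x)
    have hqe : r ^ 2 = 1 - p + p * tilt t x := hs
    have h1 : p ^ 2 * (tilt t x - 1) ^ 2 = (r - 1) ^ 2 * (r + 1) ^ 2 := by
      have : p * (tilt t x - 1) = (r - 1) * (r + 1) := by linarith
      rw [← mul_pow, this, mul_pow]
    have h2 : (r + 1) ^ 2 ≤ 4 * (1 + p * tilt t x) := by nlinarith [sq_nonneg (r - 1)]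
    have h3 : p ^ 2 * ((tilt t x - 1) ^ 2 / (1 + p * tilt t x)) ≤ 4 * (r - 1) ^ 2 := by
      rw [← mul_div_assoc, h1, div_le_iff₀ (by linarith)]
      nlinarith [mul_le_mul_of_nonneg_left h2 (sq_nonneg (r - 1))]
    beta_reduce
    rw [← hs]
    nlinarith
  rw [integral_sub i4 (i1.const_mul _),
    integral_add (i3.const_mul _) (integrable_const _), integral_const_mul, integral_const_mul,
    integral_mixDensity] at key
  refine key.trans (le_of_eq ?_)
  simp [hellingerWeight]; ring

/-- The left side is `p² (x-t)² u² / q^(3/2)`, and `q √q ≥ (1 + p u)/3`. -/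
lemma sqrt_mul_mixScore_sq_le (hp : 0 ≤ p) (hp' : p ≤ 1 / 2) (x : ℝ) :
    √(mixDensity p t x) * mixScore p t x ^ 2
      ≤ 3 * p ^ 2 * ((x - t) ^ 2 * tilt t x ^ 2 / (1 + p * tilt t x)) := by
  have hq := mixDensity_pos t hp hp' x
  have hr := sqrt_mixDensity_ge t hp hp' x
  have hs := Real.sq_sqrt hq.le
  have h1 := (mixDensity_ge t hp hp' x).1
  have h0 := one_le_one_add_mul_tilt t hp x
  unfold mixScore
  set q := mixDensity p t x
  set r := √q
  have hr0 : 0 < r := by linarith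
  have e : r * (p * (x - t) * tilt t x / q) ^ 2
      = p ^ 2 * ((x - t) ^ 2 * tilt t x ^ 2) / (q * r) := by
    rw [← hs]; field_simp
  rw [e, mul_assoc, ← mul_div_assoc, ← mul_div_assoc,
    div_le_div_iff₀ (by positivity) (by linarith)]
  have h2 : 1 + p * tilt t x ≤ 3 * (q * r) := by nlinarith
  have h3 : 0 ≤ p ^ 2 * ((x - t) ^ 2 * tilt t x ^ 2) := by positivity
  nlinarith [mul_le_mul_of_nonneg_left h2 h3]

lemma integrable_sqrt_mul_mixScore_sq (hp : 0 ≤ p) (hp' : p ≤ 1 / 2) :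
    Integrable (fun x => √(mixDensity p t x) * mixScore p t x ^ 2) gaussianStd := by
  have := continuous_mixScore t hp hp'
  refine ((integrable_div_one_add t hp (integrable_sub_pow_mul_tilt_pow t 2 2)).const_mul
    (3 * p ^ 2)).mono' (by fun_prop) (ae_of_all _ fun x => ?_)
  rw [Real.norm_eq_abs, abs_of_nonneg (by positivity)]
  exact sqrt_mul_mixScore_sq_le t hp hp' x

lemma integrable_sqrt_mul_mixScore (hp : 0 ≤ p) (hp' : p ≤ 1 / 2) :
    Integrable (fun x => √(mixDensity p t x) * mixScore p t x) gaussianStd := by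
  have := continuous_mixScore t hp hp'
  refine ((integrable_sqrt_mixDensity t hp hp').add
    (integrable_sqrt_mul_mixScore_sq t hp hp')).mono' (by fun_prop) (ae_of_all _ fun x => ?_)
  rw [Real.norm_eq_abs, abs_mul, abs_of_nonneg (Real.sqrt_nonneg _)]
  simp only [Pi.add_apply]
  rw [← sq_abs (mixScore p t x)]
  have h := Real.sqrt_nonneg (mixDensity p t x)
  nlinarith [sq_nonneg (|mixScore p t x| - 1), mul_nonneg h (sq_nonneg (|mixScore p t x| - 1)),
    mul_nonneg h (sq_nonneg (|mixScore p t x|))]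

lemma integral_sqrt_mul_mixScore_sq_le (hp : 0 ≤ p) (hp' : p ≤ 1 / 2) :
    ∫ x, √(mixDensity p t x) * mixScore p t x ^ 2 ∂gaussianStd ≤ 3 * p ^ 2 * fisherWeight p t := by
  rw [fisherWeight, ← integral_const_mul]
  exact integral_mono (integrable_sqrt_mul_mixScore_sq t hp hp')
    ((integrable_div_one_add t hp (integrable_sub_pow_mul_tilt_pow t 2 2)).const_mul _)
    fun x => sqrt_mul_mixScore_sq_le t hp hp' x

/-- Subtracting `p (x - t) u`, which has mean zero by `integral_sub_mul_tilt`, leaves a factor `1 -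
√q` of order `p (u - 1)`. This gains the factor `p² hellingerWeight` needed to offset the `n²` in
`scoreMoment`. -/
lemma sq_integral_sqrt_mul_mixScore_le (hp : 0 ≤ p) (hp' : p ≤ 1 / 2) :
    (∫ x, √(mixDensity p t x) * mixScore p t x ∂gaussianStd) ^ 2
      ≤ 4 * p ^ 4 * (fisherWeight p t * hellingerWeight p t) := by
  have i0 : Integrable (fun x => (x - t) * tilt t x) gaussianStd := by
    simpa using integrable_sub_pow_mul_tilt_pow t 1 1
  have i1 := integrable_sqrt_mul_mixScore t hp hp'
  have e : ∫ x, √(mixDensity p t x) * mixScore p t x ∂gaussianStd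
      = ∫ x, (√(mixDensity p t x) * mixScore p t x - p * ((x - t) * tilt t x)) ∂gaussianStd := by
    rw [integral_sub i1 (i0.const_mul p), integral_const_mul, integral_sub_mul_tilt]; simp
  rw [e]
  have cs := sq_integral_le_integral_mul_integral (ν := gaussianStd) (i1.sub (i0.const_mul p))
    ((integrable_div_one_add t hp (integrable_sub_pow_mul_tilt_pow t 2 2)).const_mul (4 * p ^ 4))
    (integrable_div_one_add t hp (integrable_tilt_sub_one_sq t))
    (fun x => mul_nonneg (by positivity)
      (div_nonneg (by positivity) (by linarith [one_le_one_add_mul_tilt t hp x])))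
    (fun x => div_nonneg (by positivity) (by linarith [one_le_one_add_mul_tilt t hp x]))
    (fun x => by
      have hq := mixDensity_pos t hp hp' x
      have hs := Real.sq_sqrt hq.le
      have h1 := (mixDensity_ge t hp hp' x).1
      have h0 := one_le_one_add_mul_tilt t hp x
      have hr := Real.sqrt_pos.2 hq
      have hqe : mixDensity p t x = 1 - p + p * tilt t x := rfl
      simp only [Pi.sub_apply]
      unfold mixScore
      set q := mixDensity p t x
      set r := √q
      set u := tilt t x
      have e1 : r * (p * (x - t) * u / q) - p * ((x - t) * u)
          = p * ((x - t) * u) * ((1 - r) / r) := by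
        rw [← hs]; field_simp
      have e2 : (1 - r) / r * (r + q) = p * (1 - u) := by
        have : p * (1 - u) = 1 - q := by rw [hqe]; ring
        rw [this, ← hs]; field_simp; ring
      have h2 : ((1 - r) / r) ^ 2 * (1 + p * u) ^ 2 ≤ 4 * p ^ 2 * (u - 1) ^ 2 := by
        have h3 : (1 + p * u) ^ 2 ≤ 4 * (r + q) ^ 2 := by nlinarith
        calc ((1 - r) / r) ^ 2 * (1 + p * u) ^ 2 ≤ ((1 - r) / r) ^ 2 * (4 * (r + q) ^ 2) := by
              gcongr
          _ = 4 * ((1 - r) / r * (r + q)) ^ 2 := by ring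
          _ = 4 * p ^ 2 * (u - 1) ^ 2 := by rw [e2]; ring
      have h4 : 0 < 1 + p * u := by linarith
      rw [e1]
      have e3 : 4 * p ^ 4 * ((x - t) ^ 2 * u ^ 2 / (1 + p * u)) * ((u - 1) ^ 2 / (1 + p * u))
          = (p * ((x - t) * u)) ^ 2 * (4 * p ^ 2 * (u - 1) ^ 2) / (1 + p * u) ^ 2 := by
        field_simp
      rw [e3, le_div_iff₀ (by positivity), mul_pow, mul_assoc]
      gcongr)
  refine cs.trans (le_of_eq ?_)
  rw [integral_const_mul, mul_assoc]; rfl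

end

section
variable {p : ℝ} (t : ℝ)

lemma fisherWeight_le_mul_exp (hp : 0 ≤ p) :
    fisherWeight p t ≤ (2 + t ^ 2) * Real.exp (t ^ 2) :=
  (fisherWeight_le t hp).trans
    (mul_le_mul_of_nonneg_left (integral_tilt_sq_div_le_exp t hp) (by positivity))

lemma fisherWeight_le_hellingerWeight (hp : 0 ≤ p) :
    fisherWeight p t ≤ (2 + t ^ 2) * (2 * hellingerWeight p t + 2) :=
  (fisherWeight_le t hp).trans
    (mul_le_mul_of_nonneg_left (integral_tilt_sq_div_le t hp) (by positivity))

/-- The mean square of the score of a sample of size `n`, up to a constant and a power of the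
affinity. -/
noncomputable def scoreMoment (n : ℕ) (p t : ℝ) : ℝ :=
  n * (∫ x, √(mixDensity p t x) * mixScore p t x ^ 2 ∂gaussianStd)
    + (n : ℝ) ^ 2 * (∫ x, √(mixDensity p t x) * mixScore p t x ∂gaussianStd) ^ 2

/-- With `N = n p²`, the moment is at most `N A (3 + 4 N B)` and the affinity power at most `exp (-N
B/4)`; half of that exponent absorbs the polynomial in `N B`. -/
lemma affinity_pow_mul_scoreMoment_le (n : ℕ) (hp : 0 ≤ p) (hp' : p ≤ 1 / 2) :
    affinity p t ^ (2 * n) * scoreMoment n p t ≤ 32 * (n * p ^ 2) * fisherWeight p t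
      * Real.exp (-(n * p ^ 2 * hellingerWeight p t / 8)) := by
  have h1 := affinity_le t hp hp'
  have h0 := two_thirds_le_affinity t hp hp'
  have hA := fisherWeight_nonneg t hp
  have hB := hellingerWeight_nonneg t hp
  have hJ := integral_sqrt_mul_mixScore_sq_le t hp hp'
  have hb := sq_integral_sqrt_mul_mixScore_le t hp hp'
  set A := fisherWeight p t
  set B := hellingerWeight p t
  have hn : (0 : ℝ) ≤ n := n.cast_nonneg
  have hQ : scoreMoment n p t ≤ (n * p ^ 2) * A * (3 + 4 * (n * p ^ 2 * B)) := by
    unfold scoreMoment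
    calc _ ≤ n * (3 * p ^ 2 * A) + (n : ℝ) ^ 2 * (4 * p ^ 4 * (A * B)) := by gcongr
      _ = _ := by ring
  have hρ : affinity p t ^ (2 * n) ≤ Real.exp (-(n * p ^ 2 * B / 4)) := by
    calc affinity p t ^ (2 * n) ≤ Real.exp (-(p ^ 2 * B / 8)) ^ (2 * n) := by
          gcongr
          linarith [Real.add_one_le_exp (-(p ^ 2 * B / 8))]
      _ = _ := by rw [← Real.exp_nat_mul]; congr 1; push_cast; ring
  have hy := Real.add_one_le_exp (n * p ^ 2 * B / 8)
  have hfin : Real.exp (-(n * p ^ 2 * B / 4)) * (3 + 4 * (n * p ^ 2 * B))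
      ≤ 32 * Real.exp (-(n * p ^ 2 * B / 8)) := by
    have e : Real.exp (-(n * p ^ 2 * B / 8))
        = Real.exp (-(n * p ^ 2 * B / 4)) * Real.exp (n * p ^ 2 * B / 8) := by
      rw [← Real.exp_add]; congr 1; ring
    rw [e]
    have := Real.exp_pos (-(n * p ^ 2 * B / 4))
    nlinarith
  have hN : 0 ≤ n * p ^ 2 * A := by positivity
  calc affinity p t ^ (2 * n) * scoreMoment n p t
      ≤ Real.exp (-(n * p ^ 2 * B / 4)) * ((n * p ^ 2) * A * (3 + 4 * (n * p ^ 2 * B))) := by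
        refine mul_le_mul hρ hQ ?_ (Real.exp_pos _).le
        unfold scoreMoment
        have : 0 ≤ ∫ x, √(mixDensity p t x) * mixScore p t x ^ 2 ∂gaussianStd :=
          integral_nonneg fun x => by positivity
        positivity
    _ = (n * p ^ 2) * A * (Real.exp (-(n * p ^ 2 * B / 4)) * (3 + 4 * (n * p ^ 2 * B))) := by ring
    _ ≤ (n * p ^ 2) * A * (32 * Real.exp (-(n * p ^ 2 * B / 8))) := by gcongr
    _ = _ := by ring

/-- For `|t| ≤ 1`, `B ≥ t²/18` gives a peak of height `√N` and width `1/√N`, whose mass is bounded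
in `N`. For `|t| ≥ 1`, `A ≤ 38 (2 + t²) B` and `N B exp (-N B/8) ≤ 8` remove `N` altogether. -/
lemma affinity_pow_mul_scoreMoment_le_uniform (n : ℕ) (hp : 0 ≤ p) (hp' : p ≤ 1 / 2) :
    affinity p t ^ (2 * n) * scoreMoment n p t
      ≤ (100 * (2 + |t|) + 24 * √(n * p ^ 2) * Real.exp (-(n * p ^ 2 / 288) * t ^ 2)) ^ 2 := by
  refine (affinity_pow_mul_scoreMoment_le t n hp hp').trans ?_
  have hA0 := fisherWeight_nonneg t hp
  have hA := fisherWeight_le_hellingerWeight t hp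
  have hB0 := hellingerWeight_nonneg t hp
  have hN : (0 : ℝ) ≤ n * p ^ 2 := by positivity
  set N : ℝ := n * p ^ 2
  have hs := Real.sq_sqrt hN
  have hs0 := Real.sqrt_nonneg N
  rcases le_total |t| 1 with ht | ht
  · have hB := sq_le_hellingerWeight t hp hp' ht
    have ht2 : t ^ 2 ≤ 1 := by rw [← sq_abs]; nlinarith [abs_nonneg t]
    have hB' : hellingerWeight p t ≤ 2 := by
      refine (hellingerWeight_le t hp).trans ?_
      have : Real.exp (t ^ 2) ≤ Real.exp 1 := Real.exp_le_exp.2 ht2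
      linarith [Real.exp_one_lt_d9]
    have hA' : fisherWeight p t ≤ 18 := by nlinarith
    have h1 : Real.exp (-(N * hellingerWeight p t / 8)) ≤ Real.exp (-(N / 288) * t ^ 2) ^ 2 := by
      rw [← Real.exp_nat_mul]
      refine Real.exp_le_exp.2 ?_
      push_cast
      nlinarith
    calc 32 * N * fisherWeight p t * Real.exp (-(N * hellingerWeight p t / 8))
        ≤ 32 * N * 18 * Real.exp (-(N / 288) * t ^ 2) ^ 2 := by gcongr
      _ = (24 * √N * Real.exp (-(N / 288) * t ^ 2)) ^ 2 := by rw [mul_pow, mul_pow, hs]; ring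
      _ ≤ _ := by
        have : 0 ≤ 100 * (2 + |t|) := by positivity
        have : 0 ≤ 24 * √N * Real.exp (-(N / 288) * t ^ 2) := by positivity
        gcongr
        linarith
  · have hB := one_le_hellingerWeight t hp hp' ht
    set B := hellingerWeight p t
    have h1 := Real.add_one_le_exp (N * B / 8)
    have h2 : N * B * Real.exp (-(N * B / 8)) ≤ 8 := by
      rw [Real.exp_neg, ← div_eq_mul_inv, div_le_iff₀ (Real.exp_pos _)]
      linarith
    have h3 : fisherWeight p t ≤ (2 + t ^ 2) * (38 * B) :=
      hA.trans (mul_le_mul_of_nonneg_left (by linarith) (by positivity))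
    calc 32 * N * fisherWeight p t * Real.exp (-(N * B / 8))
        ≤ 32 * N * ((2 + t ^ 2) * (38 * B)) * Real.exp (-(N * B / 8)) := by gcongr
      _ = 1216 * (2 + t ^ 2) * (N * B * Real.exp (-(N * B / 8))) := by ring
      _ ≤ 1216 * (2 + t ^ 2) * 8 := by gcongr
      _ ≤ (100 * (2 + |t|)) ^ 2 := by
        rw [← sq_abs t]
        nlinarith [abs_nonneg t]
      _ ≤ _ := by
        have : 0 ≤ 24 * √N * Real.exp (-(N / 288) * t ^ 2) := by positivity
        gcongr
        linarith

lemma affinity_pow_mul_scoreMoment_le_small (n : ℕ) (hp : 0 ≤ p) (hp' : p ≤ 1 / 2) :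
    affinity p t ^ (2 * n) * scoreMoment n p t
      ≤ 32 * (n * p ^ 2) * ((2 + t ^ 2) * Real.exp (t ^ 2)) := by
  refine (affinity_pow_mul_scoreMoment_le t n hp hp').trans ?_
  have hA0 := fisherWeight_nonneg t hp
  have hA := fisherWeight_le_mul_exp t hp
  have hB0 := hellingerWeight_nonneg t hp
  have : Real.exp (-(n * p ^ 2 * hellingerWeight p t / 8)) ≤ 1 :=
    Real.exp_le_one_iff.2 (neg_nonpos.2 (by positivity))
  calc _ ≤ 32 * (n * p ^ 2) * ((2 + t ^ 2) * Real.exp (t ^ 2)) * 1 := by gcongr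
    _ = _ := by ring
end

/-! ### The square-root likelihood of a whole sample. -/

section product
variable {n : ℕ}

/-- The law of a sample of size `n`. -/
noncomputable abbrev gaussianSample (n : ℕ) : Measure (Fin n → ℝ) :=
  Measure.pi fun _ => gaussianStd

lemma integrable_prod_mul_mul {a b : ℝ → ℝ} (i0 : Integrable a gaussianStd)
    (i1 : Integrable (fun x => a x * b x) gaussianStd)
    (i2 : Integrable (fun x => a x * b x ^ 2) gaussianStd) (i j k : Fin n) :
    Integrable (fun x => a x * (if k = i then b x else 1) * (if k = j then b x else 1))
      gaussianStd := by
  split_ifs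
  · simpa [mul_assoc, pow_two] using i2
  · simpa using i1
  · simpa using i1
  · simpa using i0

/-- The indicator factors make each term of the expanded square a product over coordinates, to which
Fubini applies. -/
lemma prod_mul_sum_sq_eq (a b : ℝ → ℝ) (x : Fin n → ℝ) :
    (∏ k, a (x k)) * (∑ k, b (x k)) ^ 2 = ∑ i, ∑ j, ∏ k,
      (a (x k) * (if k = i then b (x k) else 1) * (if k = j then b (x k) else 1)) := by
  rw [pow_two, Finset.sum_mul_sum, Finset.mul_sum]
  refine Finset.sum_congr rfl fun i _ => ?_
  rw [Finset.mul_sum]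
  refine Finset.sum_congr rfl fun j _ => ?_
  rw [Finset.prod_mul_distrib, Finset.prod_mul_distrib]
  simp [mul_assoc]

lemma integrable_prod_mul_sum_sq {a b : ℝ → ℝ} (i0 : Integrable a gaussianStd)
    (i1 : Integrable (fun x => a x * b x) gaussianStd)
    (i2 : Integrable (fun x => a x * b x ^ 2) gaussianStd) :
    Integrable (fun x : Fin n → ℝ => (∏ k, a (x k)) * (∑ k, b (x k)) ^ 2) (gaussianSample n) := by
  simp_rw [prod_mul_sum_sq_eq]
  exact integrable_finsetSum _ fun i _ => integrable_finsetSum _ fun j _ =>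
    Integrable.fintype_prod (f := fun k x => a x * (if k = i then b x else 1)
      * (if k = j then b x else 1)) fun k => integrable_prod_mul_mul i0 i1 i2 i j k

/-- The second moment of a sum under a product density. -/
lemma integral_prod_mul_sum_sq_le {a b : ℝ → ℝ} (i0 : Integrable a gaussianStd)
    (i1 : Integrable (fun x => a x * b x) gaussianStd)
    (i2 : Integrable (fun x => a x * b x ^ 2) gaussianStd)
    (h0 : 0 < ∫ x, a x ∂gaussianStd) (ha : ∀ x, 0 ≤ a x) :
    ∫ x : Fin n → ℝ, (∏ k, a (x k)) * (∑ k, b (x k)) ^ 2 ∂(gaussianSample n)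
      ≤ (∫ x, a x ∂gaussianStd) ^ n
        * (n * ((∫ x, a x * b x ^ 2 ∂gaussianStd) / ∫ x, a x ∂gaussianStd)
          + (n : ℝ) ^ 2 * ((∫ x, a x * b x ∂gaussianStd) / ∫ x, a x ∂gaussianStd) ^ 2) := by
  set I0 := ∫ x, a x ∂gaussianStd with hI0
  set I1 := ∫ x, a x * b x ∂gaussianStd with hI1
  set I2 := ∫ x, a x * b x ^ 2 ∂gaussianStd with hI2
  have hI2' : 0 ≤ I2 := integral_nonneg fun x => mul_nonneg (ha x) (sq_nonneg _)
  simp_rw [prod_mul_sum_sq_eq]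
  have hi : ∀ i j : Fin n, Integrable (fun x : Fin n → ℝ => ∏ k,
      (a (x k) * (if k = i then b (x k) else 1) * (if k = j then b (x k) else 1)))
      (gaussianSample n) := fun i j =>
    Integrable.fintype_prod (f := fun k x => a x * (if k = i then b x else 1)
      * (if k = j then b x else 1)) fun k => integrable_prod_mul_mul i0 i1 i2 i j k
  rw [integral_finsetSum _ fun i _ => integrable_finsetSum _ fun j _ => hi i j]
  simp_rw [integral_finsetSum _ fun j _ => hi _ j]
  have hij : ∀ i j : Fin n, ∫ x : Fin n → ℝ, ∏ k,
      (a (x k) * (if k = i then b (x k) else 1) * (if k = j then b (x k) else 1))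
      ∂(gaussianSample n) ≤ I0 ^ n * ((if i = j then I2 / I0 else 0) + (I1 / I0) ^ 2) := by
    intro i j
    rw [integral_fintype_prod_eq_prod (𝕜 := ℝ) (f := fun k x => a x * (if k = i then b x else 1)
      * (if k = j then b x else 1))]
    by_cases hne : i = j
    · subst hne
      have hk : ∀ k : Fin n, ∫ x, a x * (if k = i then b x else 1) * (if k = i then b x else 1)
          ∂gaussianStd = I0 * (if k = i then I2 / I0 else 1) := by
        intro k
        split_ifs
        · rw [mul_div_cancel₀ _ h0.ne', hI2]
          simp_rw [pow_two, mul_assoc]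
        · simp [hI0]
      simp_rw [hk]
      rw [Finset.prod_mul_distrib]
      simp only [Finset.prod_const, Finset.card_univ, Fintype.card_fin, Finset.prod_ite_eq',
        Finset.mem_univ, if_true]
      gcongr
      have := sq_nonneg (I1 / I0)
      linarith
    · have hk : ∀ k : Fin n, ∫ x, a x * (if k = i then b x else 1) * (if k = j then b x else 1)
          ∂gaussianStd
          = I0 * ((if k = i then I1 / I0 else 1) * (if k = j then I1 / I0 else 1)) := by
        intro k
        by_cases hki : k = i
        · have hkj : ¬ k = j := fun h => hne (hki.symm.trans h)
          simp only [hki, hne, if_true, if_false, mul_one]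
          rw [mul_div_cancel₀ _ h0.ne']
        · by_cases hkj : k = j
          · simp only [hkj, Ne.symm hne, if_true, if_false, mul_one, one_mul]
            rw [mul_div_cancel₀ _ h0.ne']
          · simp [hki, hkj, hI0]
      simp_rw [hk]
      rw [Finset.prod_mul_distrib, Finset.prod_mul_distrib]
      simp only [Finset.prod_const, Finset.card_univ, Fintype.card_fin, Finset.prod_ite_eq',
        Finset.mem_univ, if_true, hne, if_false]
      rw [zero_add, pow_two]
  calc _ ≤ ∑ i : Fin n, ∑ j : Fin n,
        I0 ^ n * ((if i = j then I2 / I0 else 0) + (I1 / I0) ^ 2) :=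
        Finset.sum_le_sum fun i _ => Finset.sum_le_sum fun j _ => hij i j
    _ = _ := by
      simp only [← Finset.mul_sum, Finset.sum_add_distrib, Finset.sum_ite_eq, Finset.mem_univ,
        if_true, Finset.sum_const, Finset.card_univ, Fintype.card_fin, nsmul_eq_mul]
      ring

/-- The square root of the likelihood ratio of the mixture. -/
noncomputable def sqrtLikelihood (p t : ℝ) (x : Fin n → ℝ) : ℝ :=
  Real.exp (logLikelihood p t x / 2)

/-- The derivative of `sqrtLikelihood p t x` in `t`. -/
noncomputable def sqrtLikelihoodDeriv (p t : ℝ) (x : Fin n → ℝ) : ℝ :=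
  sqrtLikelihood p t x * ((∑ i, mixScore p t (x i)) / 2)

variable {p : ℝ}

lemma hasDerivAt_logLikelihood (hp : 0 ≤ p) (hp' : p ≤ 1 / 2) (x : Fin n → ℝ) (t : ℝ) :
    HasDerivAt (fun t => logLikelihood p t x) (∑ i, mixScore p t (x i)) t := by
  unfold logLikelihood
  refine HasDerivAt.fun_sum fun i _ => ?_
  have h1 : HasDerivAt (fun t => t * x i - t ^ 2 / 2) (x i - t) t := by
    have h := ((hasDerivAt_id' t).mul_const (x i)).fun_sub
      (((hasDerivAt_id' t).fun_pow 2).div_const 2)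
    refine h.congr_deriv ?_
    simp
  have h2 := ((h1.exp.const_mul p).const_add (1 - p)).log
    (mixDensity_pos t hp hp' (x i)).ne'
  refine h2.congr_deriv ?_
  unfold mixScore mixDensity tilt
  ring

lemma hasDerivAt_sqrtLikelihood (hp : 0 ≤ p) (hp' : p ≤ 1 / 2) (x : Fin n → ℝ) (t : ℝ) :
    HasDerivAt (fun t => sqrtLikelihood p t x) (sqrtLikelihoodDeriv p t x) t :=
  ((hasDerivAt_logLikelihood hp hp' x t).div_const 2).exp

lemma sqrtLikelihood_eq_prod (hp : 0 ≤ p) (hp' : p ≤ 1 / 2) (t : ℝ) (x : Fin n → ℝ) :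
    sqrtLikelihood p t x = ∏ i, √(mixDensity p t (x i)) := by
  unfold sqrtLikelihood logLikelihood
  rw [Finset.sum_div, Real.exp_sum]
  refine Finset.prod_congr rfl fun i _ => ?_
  change Real.exp (Real.log (mixDensity p t (x i)) / 2) = _
  rw [← Real.log_sqrt (mixDensity_pos t hp hp' (x i)).le,
    Real.exp_log (Real.sqrt_pos.2 (mixDensity_pos t hp hp' (x i)))]

lemma sqrtLikelihood_zero (x : Fin n → ℝ) : sqrtLikelihood p 0 x = 1 := by
  simp [sqrtLikelihood, logLikelihood]

lemma measurable_sqrtLikelihoodDeriv :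
    Measurable (fun z : ℝ × (Fin n → ℝ) => sqrtLikelihoodDeriv p z.1 z.2) := by
  unfold sqrtLikelihoodDeriv sqrtLikelihood logLikelihood mixScore mixDensity tilt
  fun_prop

lemma integrable_sqrtLikelihood (hp : 0 ≤ p) (hp' : p ≤ 1 / 2) (t : ℝ) :
    Integrable (fun x : Fin n → ℝ => sqrtLikelihood p t x) (gaussianSample n) := by
  simp_rw [sqrtLikelihood_eq_prod hp hp']
  exact Integrable.fintype_prod (f := fun _ x => √(mixDensity p t x))
    fun _ => integrable_sqrt_mixDensity t hp hp'

lemma integral_sqrtLikelihood (hp : 0 ≤ p) (hp' : p ≤ 1 / 2) (t : ℝ) :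
    ∫ x : Fin n → ℝ, sqrtLikelihood p t x ∂(gaussianSample n) = affinity p t ^ n := by
  simp_rw [sqrtLikelihood_eq_prod hp hp']
  rw [integral_fintype_prod_eq_pow (fun x => √(mixDensity p t x)), Fintype.card_fin]
  rfl

/-- Cauchy–Schwarz between `g` and `g (score/2)²`. Dividing by the affinity costs at most a factor
`4`, since the affinity is at least `2/3`; this cancels the `1/4` of the halved score. -/
lemma integrable_sqrtLikelihoodDeriv (hp : 0 ≤ p) (hp' : p ≤ 1 / 2) (t : ℝ) :
    Integrable (fun x : Fin n → ℝ => |sqrtLikelihoodDeriv p t x|) (gaussianSample n) ∧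
      (∫ x : Fin n → ℝ, |sqrtLikelihoodDeriv p t x| ∂(gaussianSample n)) ^ 2
        ≤ affinity p t ^ (2 * n) * scoreMoment n p t := by
  have i0 := integrable_sqrt_mixDensity t hp hp'
  have i1 := integrable_sqrt_mul_mixScore t hp hp'
  have i2 := integrable_sqrt_mul_mixScore_sq t hp hp'
  have hρ : 2 / 3 ≤ affinity p t := two_thirds_le_affinity t hp hp'
  have j0 := integrable_sqrtLikelihood (n := n) hp hp' t
  have j2 := integrable_prod_mul_sum_sq (n := n) i0 i1 i2
  have l2 := integral_prod_mul_sum_sq_le (n := n) i0 i1 i2 (by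
    change 0 < affinity p t; linarith) fun x => Real.sqrt_nonneg _
  simp_rw [← sqrtLikelihood_eq_prod hp hp'] at j2 l2
  have hm : AEStronglyMeasurable (fun x : Fin n → ℝ => |sqrtLikelihoodDeriv p t x|)
      (gaussianSample n) :=
    ((measurable_sqrtLikelihoodDeriv (p := p)).comp
      (measurable_const.prodMk measurable_id)).abs.aestronglyMeasurable
  have hi : Integrable (fun x : Fin n → ℝ => |sqrtLikelihoodDeriv p t x|) (gaussianSample n) := by
    refine (j0.add j2).mono' hm (ae_of_all _ fun x => ?_)
    have hg : 0 < sqrtLikelihood p t x := Real.exp_pos _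
    simp only [Pi.add_apply, sqrtLikelihoodDeriv]
    rw [Real.norm_eq_abs, abs_abs, abs_mul, abs_of_pos hg, abs_div, abs_two]
    set S := ∑ i, mixScore p t (x i)
    rw [← sq_abs S]
    have : |S| / 2 ≤ 1 + |S| ^ 2 := by nlinarith [sq_nonneg (|S| - 1)]
    calc _ ≤ sqrtLikelihood p t x * (1 + |S| ^ 2) := by gcongr
      _ = _ := by ring
  refine ⟨hi, ?_⟩
  have cs := sq_integral_le_integral_mul_integral hi j0 (j2.const_mul (1 / 4))
    (fun x => (Real.exp_pos _).le)
    (fun x => mul_nonneg (by norm_num) (mul_nonneg (Real.exp_pos _).le (sq_nonneg _)))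
    (fun x => by rw [sq_abs, sqrtLikelihoodDeriv]; apply le_of_eq; ring)
  rw [integral_const_mul, integral_sqrtLikelihood hp hp'] at cs
  refine cs.trans ?_
  unfold scoreMoment
  change _ ≤ affinity p t ^ n * (n * (_ / affinity p t) + (n : ℝ) ^ 2 * (_ / affinity p t) ^ 2)
    at l2
  set J := ∫ x, √(mixDensity p t x) * mixScore p t x ^ 2 ∂gaussianStd
  set β := ∫ x, √(mixDensity p t x) * mixScore p t x ∂gaussianStd
  have hJ : 0 ≤ J := integral_nonneg fun x => by positivity
  have e1 : J / affinity p t ≤ 4 * J := by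
    rw [div_le_iff₀ (by linarith)]; nlinarith
  have e2 : (β / affinity p t) ^ 2 ≤ 4 * β ^ 2 := by
    rw [div_pow, div_le_iff₀ (by positivity)]
    have : 1 ≤ 4 * affinity p t ^ 2 := by nlinarith
    nlinarith [sq_nonneg β]
  have hρn : 0 ≤ affinity p t ^ n := by positivity
  calc affinity p t ^ n * (1 / 4 * _)
      ≤ affinity p t ^ n * (1 / 4 * (affinity p t ^ n
        * (n * (J / affinity p t) + (n : ℝ) ^ 2 * (β / affinity p t) ^ 2))) := by gcongr
    _ ≤ affinity p t ^ n * (1 / 4 * (affinity p t ^ n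
        * (n * (4 * J) + (n : ℝ) ^ 2 * (4 * β ^ 2)))) := by gcongr
    _ = _ := by rw [two_mul, pow_add]; ring

lemma integral_abs_sqrtLikelihoodDeriv_le (hp : 0 ≤ p) (hp' : p ≤ 1 / 2) (t : ℝ) :
    ∫ x : Fin n → ℝ, |sqrtLikelihoodDeriv p t x| ∂(gaussianSample n)
      ≤ 100 * (2 + |t|) + 24 * √(n * p ^ 2) * Real.exp (-(n * p ^ 2 / 288) * t ^ 2) :=
  (le_abs_self _).trans (abs_le_of_sq_le_sq (((integrable_sqrtLikelihoodDeriv hp hp' t).2).trans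
    (affinity_pow_mul_scoreMoment_le_uniform t n hp hp')) (by positivity))

lemma integral_abs_sqrtLikelihoodDeriv_le_small (hp : 0 ≤ p) (hp' : p ≤ 1 / 2) (t : ℝ) :
    ∫ x : Fin n → ℝ, |sqrtLikelihoodDeriv p t x| ∂(gaussianSample n)
      ≤ √(32 * (n * p ^ 2) * ((2 + t ^ 2) * Real.exp (t ^ 2))) :=
  Real.le_sqrt_of_sq_le (((integrable_sqrtLikelihoodDeriv hp hp' t).2).trans
    (affinity_pow_mul_scoreMoment_le_small t n hp hp'))

end product

/-! ### From variation in `t` to the supremum over `t`. -/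

/-- For `s ≥ 0` and `g ≥ 0` the derivative of the damping contributes `-2 c s g exp (-c s²) ≤ 0` and
is dropped. -/
lemma ofReal_mul_exp_sub_le_lintegral_of_nonneg {g g' : ℝ → ℝ} {c : ℝ} (hc : 0 ≤ c)
    (hg : ∀ t, HasDerivAt g (g' t) t) (hg' : Continuous g') (h0 : ∀ t, 0 ≤ g t) {t : ℝ}
    (ht : 0 ≤ t) :
    ENNReal.ofReal (g t * Real.exp (-c * t ^ 2) - g 0)
      ≤ ∫⁻ s, ENNReal.ofReal (|g' s| * Real.exp (-c * s ^ 2)) := by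
  have hgc : Continuous g := continuous_iff_continuousAt.2 fun t => (hg t).continuousAt
  have hd : ∀ s, HasDerivAt (fun s => g s * Real.exp (-c * s ^ 2))
      ((g' s - 2 * c * s * g s) * Real.exp (-c * s ^ 2)) s := by
    intro s
    have h1 : HasDerivAt (fun s : ℝ => -c * s ^ 2) (-c * (2 * s)) s := by
      simpa using ((hasDerivAt_id' s).fun_pow 2).const_mul (-c)
    refine ((hg s).fun_mul h1.exp).congr_deriv ?_
    ring
  have hint := intervalIntegral.integral_eq_sub_of_hasDerivAt (a := 0) (b := t)
    (fun s _ => hd s) (Continuous.intervalIntegrable (by fun_prop) _ _)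
  have hcont : Continuous fun s => |g' s| * Real.exp (-c * s ^ 2) := by fun_prop
  have hle : ∫ s in (0 : ℝ)..t, (g' s - 2 * c * s * g s) * Real.exp (-c * s ^ 2)
      ≤ ∫ s in (0 : ℝ)..t, |g' s| * Real.exp (-c * s ^ 2) := by
    refine intervalIntegral.integral_mono_on ht (Continuous.intervalIntegrable (by fun_prop) _ _)
      (hcont.intervalIntegrable _ _) fun s hs => ?_
    gcongr
    have : 0 ≤ 2 * c * s * g s := by have := hs.1; have := h0 s; positivity
    linarith [le_abs_self (g' s)]
  rw [hint] at hle
  simp only [ne_eq, OfNat.ofNat_ne_zero, not_false_eq_true, zero_pow, mul_zero, Real.exp_zero,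
    mul_one] at hle
  refine (ENNReal.ofReal_le_ofReal hle).trans ?_
  rw [intervalIntegral.integral_of_le ht, ofReal_integral_eq_lintegral_ofReal
    ((intervalIntegrable_iff_integrableOn_Ioc_of_le ht).1 (hcont.intervalIntegrable _ _))
    (ae_of_all _ fun s => by positivity)]
  exact setLIntegral_le_lintegral _ _

/-- A supremum bound by the total variation, for a function damped by a Gaussian factor. -/
lemma ofReal_mul_exp_sub_le_lintegral {g g' : ℝ → ℝ} {c : ℝ} (hc : 0 ≤ c)
    (hg : ∀ t, HasDerivAt g (g' t) t) (hg' : Continuous g') (h0 : ∀ t, 0 ≤ g t) (t : ℝ) :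
    ENNReal.ofReal (g t * Real.exp (-c * t ^ 2) - g 0)
      ≤ ∫⁻ s, ENNReal.ofReal (|g' s| * Real.exp (-c * s ^ 2)) := by
  rcases le_total 0 t with ht | ht
  · exact ofReal_mul_exp_sub_le_lintegral_of_nonneg hc hg hg' h0 ht
  · have h := ofReal_mul_exp_sub_le_lintegral_of_nonneg (g := fun s => g (-s))
      (g' := fun s => -g' (-s)) hc (fun s => by
        have h := (hg (-s)).comp s (hasDerivAt_neg s)
        rw [mul_neg_one] at h
        exact h) (by fun_prop) (fun s => h0 _)
      (neg_nonneg.2 ht)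
    simp only [neg_neg, neg_zero, abs_neg, neg_sq] at h
    refine h.trans (le_of_eq ?_)
    have := (Measure.measurePreserving_neg (volume : Measure ℝ)).lintegral_comp_emb
      (MeasurableEquiv.neg ℝ).measurableEmbedding
      (fun s => ENNReal.ofReal (|g' s| * Real.exp (-c * s ^ 2)))
    simpa using this

section
variable {n : ℕ} {p : ℝ}

/-- The total variation in `t` of the square root of the likelihood ratio, damped by a Gaussian
factor. -/
noncomputable def dampedVariation (c p : ℝ) (x : Fin n → ℝ) : ENNReal :=
  ∫⁻ s, ENNReal.ofReal (|sqrtLikelihoodDeriv p s x| * Real.exp (-c * s ^ 2))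

lemma measurable_dampedVariation_integrand (c p : ℝ) :
    Measurable (fun z : ℝ × (Fin n → ℝ) =>
      ENNReal.ofReal (|sqrtLikelihoodDeriv p z.1 z.2| * Real.exp (-c * z.1 ^ 2))) := by
  have h := measurable_sqrtLikelihoodDeriv (n := n) (p := p)
  have h2 : Measurable fun z : ℝ × (Fin n → ℝ) => |sqrtLikelihoodDeriv p z.1 z.2| := h.abs
  exact (h2.mul (by fun_prop)).ennreal_ofReal

lemma measurable_dampedVariation (c p : ℝ) :
    Measurable (fun x : Fin n → ℝ => dampedVariation c p x) :=
  (measurable_dampedVariation_integrand c p).lintegral_prod_left'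

lemma continuous_sqrtLikelihoodDeriv (hp : 0 ≤ p) (hp' : p ≤ 1 / 2) (x : Fin n → ℝ) :
    Continuous fun t => sqrtLikelihoodDeriv p t x := by
  have h1 : Continuous fun t => sqrtLikelihood p t x :=
    continuous_iff_continuousAt.2 fun t => (hasDerivAt_sqrtLikelihood hp hp' x t).continuousAt
  unfold sqrtLikelihoodDeriv
  refine h1.mul (Continuous.div_const (continuous_finsetSum _ fun i _ => ?_) _)
  unfold mixScore
  refine Continuous.div (by unfold tilt; fun_prop) (by unfold mixDensity tilt; fun_prop)
    fun t => (mixDensity_pos t hp hp' _).ne'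

lemma lintegral_dampedVariation_eq (c : ℝ) (hp : 0 ≤ p) (hp' : p ≤ 1 / 2) :
    ∫⁻ x : Fin n → ℝ, dampedVariation c p x ∂(gaussianSample n)
      = ∫⁻ s, ENNReal.ofReal ((∫ x : Fin n → ℝ, |sqrtLikelihoodDeriv p s x| ∂(gaussianSample n))
          * Real.exp (-c * s ^ 2)) := by
  unfold dampedVariation
  rw [lintegral_lintegral_swap (f := fun (x : Fin n → ℝ) s =>
    ENNReal.ofReal (|sqrtLikelihoodDeriv p s x| * Real.exp (-c * s ^ 2)))
    ((measurable_dampedVariation_integrand c p).comp measurable_swap).aemeasurable]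
  refine lintegral_congr fun s => ?_
  rw [← integral_mul_const, ofReal_integral_eq_lintegral_ofReal
    ((integrable_sqrtLikelihoodDeriv hp hp' s).1.mul_const _)
    (ae_of_all _ fun x => mul_nonneg (abs_nonneg _) (Real.exp_pos _).le)]

lemma integrable_add_abs_mul_exp {c : ℝ} (hc : 0 < c) (a b : ℝ) :
    Integrable fun s : ℝ => (a + b * |s|) * Real.exp (-c * s ^ 2) := by
  have h1 := integrable_exp_neg_mul_sq hc
  have h2 := (integrable_mul_exp_neg_mul_sq hc).abs
  refine ((h1.const_mul a).add (h2.const_mul b)).congr (ae_of_all _ fun s => ?_)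
  simp only [Pi.add_apply, abs_mul, Real.abs_exp]
  ring

/-- The Gaussian mass is scale invariant, so the peak near `t = 0` costs a constant however large
`N` is. -/
lemma integral_sqrt_mul_exp_le (N : ℝ) (hN : 0 ≤ N) :
    ∫ s : ℝ, √N * Real.exp (-(N / 288) * s ^ 2) ≤ √(288 * Real.pi) := by
  rw [integral_const_mul, integral_gaussian, ← Real.sqrt_mul hN]
  rcases hN.eq_or_lt with rfl | h
  · simp
  · apply le_of_eq; congr 1; field_simp

/-- The expected damped variation is bounded uniformly in the sample size and the mixing ratio. -/
lemma exists_lintegral_dampedVariation_le {c : ℝ} (hc : 0 < c) :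
    ∃ C : ℝ, 0 ≤ C ∧ ∀ (n : ℕ) (p : ℝ), 0 ≤ p → p ≤ 1 / 2 →
      ∫⁻ x : Fin n → ℝ, dampedVariation c p x ∂(gaussianSample n) ≤ ENNReal.ofReal C := by
  have i1 := integrable_add_abs_mul_exp hc 200 100
  refine ⟨(∫ s : ℝ, (200 + 100 * |s|) * Real.exp (-c * s ^ 2)) + 24 * √(288 * Real.pi),
    add_nonneg (integral_nonneg fun s => by positivity) (by positivity), fun n p hp hp' => ?_⟩
  rw [lintegral_dampedVariation_eq c hp hp']
  set N : ℝ := n * p ^ 2 with hNdef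
  have hN : 0 ≤ N := by positivity
  have h0 : ∀ s : ℝ, ENNReal.ofReal ((∫ x : Fin n → ℝ, |sqrtLikelihoodDeriv p s x|
      ∂(gaussianSample n)) * Real.exp (-c * s ^ 2))
      ≤ ENNReal.ofReal ((200 + 100 * |s|) * Real.exp (-c * s ^ 2))
        + ENNReal.ofReal (24 * (√N * Real.exp (-(N / 288) * s ^ 2))) := by
    intro s
    rw [← ENNReal.ofReal_add (by positivity) (by positivity)]
    refine ENNReal.ofReal_le_ofReal ?_
    have h := integral_abs_sqrtLikelihoodDeriv_le (n := n) hp hp' s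
    have he : Real.exp (-c * s ^ 2) ≤ 1 :=
      Real.exp_le_one_iff.2 (by nlinarith [sq_nonneg s])
    calc _ ≤ (100 * (2 + |s|) + 24 * √N * Real.exp (-(N / 288) * s ^ 2))
          * Real.exp (-c * s ^ 2) := by gcongr
      _ = (200 + 100 * |s|) * Real.exp (-c * s ^ 2)
          + 24 * (√N * Real.exp (-(N / 288) * s ^ 2)) * Real.exp (-c * s ^ 2) := by ring
      _ ≤ (200 + 100 * |s|) * Real.exp (-c * s ^ 2)
          + 24 * (√N * Real.exp (-(N / 288) * s ^ 2)) * 1 := by gcongr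
      _ = _ := by ring
  refine (lintegral_mono h0).trans ?_
  rw [lintegral_add_left (by fun_prop), ENNReal.ofReal_add
    (integral_nonneg fun s => by positivity) (by positivity)]
  refine add_le_add (ofReal_integral_eq_lintegral_ofReal i1
    (ae_of_all _ fun s => by positivity)).ge ?_
  have i2 : Integrable fun s : ℝ => 24 * (√N * Real.exp (-(N / 288) * s ^ 2)) := by
    rcases hN.eq_or_lt with h | h
    · rw [← h]; simp
    · exact ((integrable_exp_neg_mul_sq (by positivity)).const_mul _).const_mul _
  rw [← ofReal_integral_eq_lintegral_ofReal i2 (ae_of_all _ fun s => by positivity)]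
  refine ENNReal.ofReal_le_ofReal ?_
  rw [integral_const_mul]
  exact mul_le_mul_of_nonneg_left (integral_sqrt_mul_exp_le N hN) (by norm_num)

/-- A bound of the expected damped variation that vanishes with `N = n p ^ 2`. -/
noncomputable def variationBound (c N : ℝ) : ENNReal :=
  ∫⁻ s, ENNReal.ofReal (min (100 * (2 + |s|) + 24 * √N)
    √(32 * N * ((2 + s ^ 2) * Real.exp (s ^ 2))) * Real.exp (-c * s ^ 2))

lemma lintegral_dampedVariation_le_variationBound (c : ℝ) (hp : 0 ≤ p) (hp' : p ≤ 1 / 2) :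
    ∫⁻ x : Fin n → ℝ, dampedVariation c p x ∂(gaussianSample n)
      ≤ variationBound c (n * p ^ 2) := by
  rw [lintegral_dampedVariation_eq c hp hp']
  refine lintegral_mono fun s => ENNReal.ofReal_le_ofReal ?_
  refine mul_le_mul_of_nonneg_right (le_min ?_ ?_) (Real.exp_pos _).le
  · refine (integral_abs_sqrtLikelihoodDeriv_le hp hp' s).trans ?_
    have : Real.exp (-(n * p ^ 2 / 288) * s ^ 2) ≤ 1 :=
      Real.exp_le_one_iff.2 (by
        have : 0 ≤ n * p ^ 2 / 288 * s ^ 2 := by positivity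
        linarith)
    have h2 : 24 * √(n * p ^ 2) * Real.exp (-(n * p ^ 2 / 288) * s ^ 2)
        ≤ 24 * √(n * p ^ 2) * 1 := by gcongr
    linarith
  · exact integral_abs_sqrtLikelihoodDeriv_le_small hp hp' s

/-- Dominated convergence. The second entry of the minimum gives the pointwise limit, but its growth
`exp (s²/2)` need not be integrable against `exp (-c s²)`; the first entry provides the domination.
-/
lemma tendsto_variationBound {c : ℝ} (hc : 0 < c) :
    Tendsto (variationBound c) (𝓝 0) (𝓝 0) := by
  have i1 := integrable_add_abs_mul_exp hc 224 100
  have h := tendsto_lintegral_filter_of_dominated_convergence (μ := (volume : Measure ℝ))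
    (l := 𝓝 (0 : ℝ)) (f := fun _ => 0)
    (F := fun N s => ENNReal.ofReal (min (100 * (2 + |s|) + 24 * √N)
      √(32 * N * ((2 + s ^ 2) * Real.exp (s ^ 2))) * Real.exp (-c * s ^ 2)))
    (fun s => ENNReal.ofReal ((224 + 100 * |s|) * Real.exp (-c * s ^ 2)))
    (Eventually.of_forall fun N => by fun_prop)
    ((eventually_le_nhds (zero_lt_one' ℝ)).mono fun N hN => ae_of_all _ fun s => by
      refine ENNReal.ofReal_le_ofReal (mul_le_mul_of_nonneg_right ?_ (Real.exp_pos _).le)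
      refine (min_le_left _ _).trans ?_
      have : √N ≤ 1 := Real.sqrt_le_one.2 hN
      linarith)
    (by
      rw [← ofReal_integral_eq_lintegral_ofReal i1 (ae_of_all _ fun s => by positivity)]
      exact ENNReal.ofReal_ne_top)
    (ae_of_all _ fun s => by
      have hcont : Continuous fun N : ℝ => ENNReal.ofReal (min (100 * (2 + |s|) + 24 * √N)
          √(32 * N * ((2 + s ^ 2) * Real.exp (s ^ 2))) * Real.exp (-c * s ^ 2)) :=
        ENNReal.continuous_ofReal.comp (by fun_prop)
      have := hcont.tendsto 0
      simp only [Real.sqrt_zero, mul_zero, zero_mul] at this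
      rw [min_eq_right (by positivity)] at this
      simpa using this)
  rw [lintegral_zero] at h
  exact h

/-- The hypothesis says `g(t) exp (-c t²) > exp (δ/2)`, whereas `g(0) = 1`; the square root halves
both `2c` and `δ`. -/
lemma ofReal_le_dampedVariation {c δ : ℝ} (hc : 0 ≤ c) (hp : 0 ≤ p) (hp' : p ≤ 1 / 2)
    {x : Fin n → ℝ} {t : ℝ} (h : 2 * c * t ^ 2 + δ < logLikelihood p t x) :
    ENNReal.ofReal (Real.exp (δ / 2) - 1) ≤ dampedVariation c p x := by
  refine le_trans (ENNReal.ofReal_le_ofReal ?_) (ofReal_mul_exp_sub_le_lintegral hc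
    (fun t => hasDerivAt_sqrtLikelihood hp hp' x t) (continuous_sqrtLikelihoodDeriv hp hp' x)
    (fun t => (Real.exp_pos _).le) t)
  rw [sqrtLikelihood_zero, sqrtLikelihood, ← Real.exp_add]
  gcongr
  linarith

/-- The tail of the damped supremum of the log-likelihood ratio. -/
lemma measure_exists_lt_logLikelihood_le {c δ : ℝ} (hc : 0 ≤ c) (hδ : 0 < δ) (hp : 0 ≤ p)
    (hp' : p ≤ 1 / 2) {K : ENNReal}
    (hK : ∫⁻ x : Fin n → ℝ, dampedVariation c p x ∂(gaussianSample n) ≤ K) :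
    gaussianSample n {x | ∃ t : ℝ, 2 * c * t ^ 2 + δ < logLikelihood p t x}
      ≤ K / ENNReal.ofReal (Real.exp (δ / 2) - 1) := by
  have h1 : {x : Fin n → ℝ | ∃ t : ℝ, 2 * c * t ^ 2 + δ < logLikelihood p t x}
      ⊆ {x | ENNReal.ofReal (Real.exp (δ / 2) - 1) ≤ dampedVariation c p x} := by
    rintro x ⟨t, ht⟩
    exact ofReal_le_dampedVariation hc hp hp' ht
  have hpos : 0 < Real.exp (δ / 2) - 1 := by
    have := Real.add_one_lt_exp (x := δ / 2) (by positivity)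
    linarith
  refine (measure_mono h1).trans ((meas_ge_le_lintegral_div
    (measurable_dampedVariation c p).aemeasurable ?_ ENNReal.ofReal_ne_top).trans ?_)
  · simpa using hpos
  · gcongr

end

/-! ### Transfer to the law of the observations. -/

section
variable {Ω : Type*} [MeasurableSpace Ω] {μ : Measure Ω}
  {X : ℕ → Ω → ℝ}

lemma map_sample_eq (hX : ∀ i, HasLaw (X i) (gaussianReal 0 1) μ) (hind : iIndepFun X μ) (n : ℕ) :
    μ.map (sample X n) = gaussianSample n := by
  have h : iIndepFun (fun i : Fin n => X i) μ := hind.precomp Fin.val_injective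
  have := iIndepFun.map_fun_eq_pi_map (fun i : Fin n => (hX i).aemeasurable) h
  simp only [(hX _).map_eq] at this
  exact this

/-- Stated as an inequality for arbitrary sets, so that events quantified over all real `t` need no
measurability. -/
lemma measure_sample_le (hX : ∀ i, HasLaw (X i) (gaussianReal 0 1) μ) (hind : iIndepFun X μ)
    (n : ℕ) (s : Set (Fin n → ℝ)) : μ {ω | sample X n ω ∈ s} ≤ gaussianSample n s := by
  have hm : AEMeasurable (sample X n) μ :=
    aemeasurable_pi_lambda _ fun i => (hX i).aemeasurable
  rw [← map_sample_eq hX hind n]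
  exact Measure.le_map_apply hm s

end

/-! ### Deterministic asymptotics of the cost and its minimum over the weight. -/

lemma exists_abs_entropyMin_add_mixingCost_sub_log_le {φ σ c : ℝ} (hφ : 0 < φ) (hσ : 0 < σ)
    (hc : 0 < c) :
    ∃ C, ∀ (n : ℕ) (m : ℝ), c ≤ m → m ≤ n / 2 → 1 ≤ n →
      |entropyMin n m + mixingCost φ σ n m - (φ * Real.log (n / m) + Real.log m)| ≤ C := by
  obtain ⟨C, hC⟩ := exists_abs_entropyMin_add_mixingCost_sub_le hφ hσ
  refine ⟨C + |2 * φ - 1 / 2| * Real.log 2 + |φ - 1 / 2| * Real.log 2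
    + |φ - 1| * Real.log (1 + 1 / c), fun n m hcm hmn hn => ?_⟩
  have hn1 : (1 : ℝ) ≤ n := by exact_mod_cast hn
  have hn0 : (0 : ℝ) < n := by linarith
  have hm0 : 0 < m := hc.trans_le hcm
  have h := hC n m hm0.le (by linarith)
  rw [Real.log_div hn0.ne' hm0.ne']
  have hl2 : 0 ≤ Real.log 2 := Real.log_nonneg (by norm_num)
  have a1 : |Real.log (n + 1) - Real.log n| ≤ Real.log 2 := by
    rw [abs_of_nonneg (sub_nonneg.2 (Real.log_le_log hn0 (by linarith))), sub_le_iff_le_add,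
      ← Real.log_mul (by norm_num) hn0.ne']
    exact Real.log_le_log (by linarith) (by linarith)
  have a2 : |Real.log (n - m + 1) - Real.log n| ≤ Real.log 2 := by
    rw [abs_le]
    constructor
    · rw [neg_le_sub_iff_le_add, ← Real.log_mul (by linarith) (by norm_num)]
      exact Real.log_le_log hn0 (by linarith)
    · rw [sub_le_iff_le_add, ← Real.log_mul (by norm_num) hn0.ne']
      exact Real.log_le_log (by linarith) (by linarith)
  have a3 : |Real.log (m + 1) - Real.log m| ≤ Real.log (1 + 1 / c) := by
    rw [abs_of_nonneg (sub_nonneg.2 (Real.log_le_log hm0 (by linarith))), sub_le_iff_le_add,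
      ← Real.log_mul (by positivity) hm0.ne']
    refine Real.log_le_log (by linarith) ?_
    have : 1 ≤ 1 / c * m := by rw [one_div_mul_eq_div, le_div_iff₀ hc]; linarith
    linarith
  have b1 : |(2 * φ - 1 / 2) * (Real.log (n + 1) - Real.log n)| ≤ |2 * φ - 1 / 2| * Real.log 2 := by
    rw [abs_mul]; gcongr
  have b2 : |(φ - 1 / 2) * (Real.log (n - m + 1) - Real.log n)| ≤ |φ - 1 / 2| * Real.log 2 := by
    rw [abs_mul]; gcongr
  have b3 : |(φ - 1) * (Real.log (m + 1) - Real.log m)| ≤ |φ - 1| * Real.log (1 + 1 / c) := by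
    rw [abs_mul]; gcongr
  rw [abs_le] at h b1 b2 b3 ⊢
  constructor <;> linarith [h.1, h.2, b1.1, b1.2, b2.1, b2.2, b3.1, b3.2]

lemma exists_min_mul_log_le_entropyMin_add_mixingCost {φ σ : ℝ} (hφ : 0 < φ) (hσ : 0 < σ) :
    ∃ C, ∀ (n : ℕ) (m : ℝ), 0 ≤ m → m ≤ n → 1 ≤ n →
      min φ 1 * Real.log n - C ≤ entropyMin n m + mixingCost φ σ n m := by
  obtain ⟨C, hC⟩ := exists_abs_entropyMin_add_mixingCost_sub_le hφ hσ
  refine ⟨C + (|φ - 1| + |φ - 1 / 2|) * Real.log 2, fun n m h0 hmn hn => ?_⟩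
  have hn1 : (1 : ℝ) ≤ n := by exact_mod_cast hn
  have h := (abs_le.1 (hC n m h0 hmn)).1
  have hl2 : 0 ≤ Real.log 2 := Real.log_nonneg (by norm_num)
  have hL : Real.log n ≤ Real.log (n + 1) := Real.log_le_log (by linarith) (by linarith)
  have hmin : 0 ≤ min φ 1 := le_min hφ.le zero_le_one
  have ha0 : 0 ≤ Real.log (n - m + 1) := Real.log_nonneg (by linarith)
  have haL : Real.log (n - m + 1) ≤ Real.log (n + 1) := Real.log_le_log (by linarith) (by linarith)
  have hb0 : 0 ≤ Real.log (m + 1) := Real.log_nonneg (by linarith)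
  have hbL : Real.log (m + 1) ≤ Real.log (n + 1) := Real.log_le_log (by linarith) (by linarith)
  have hmL := mul_le_mul_of_nonneg_left hL hmin
  have hLL : 0 ≤ Real.log (n + 1) := ha0.trans haL
  have p1 := mul_le_mul_of_nonneg_right (neg_le_abs (φ - 1)) hl2
  have p2 := mul_le_mul_of_nonneg_right (neg_le_abs (φ - 1 / 2)) hl2
  have p1' := mul_nonneg (abs_nonneg (φ - 1)) hl2
  have p2' := mul_nonneg (abs_nonneg (φ - 1 / 2)) hl2
  have hminφ := mul_le_mul_of_nonneg_right (min_le_left φ 1) hLL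
  have hmin1 := mul_le_mul_of_nonneg_right (min_le_right φ 1) hLL
  have q1 : ∀ z : ℝ, 0 ≤ z → z ≤ Real.log 2 → |(φ - 1) * z| ≤ |φ - 1| * Real.log 2 := by
    intro z hz hz'
    rw [abs_mul, abs_of_nonneg hz]; gcongr
  have q2 : ∀ z : ℝ, 0 ≤ z → z ≤ Real.log 2 → |(φ - 1 / 2) * z| ≤ |φ - 1 / 2| * Real.log 2 := by
    intro z hz hz'
    rw [abs_mul, abs_of_nonneg hz]; gcongr
  -- One of `log (n - m + 1)` and `log (m + 1)` is within `log 2` of `log (n + 1)`. What remains is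
  -- affine in the other logarithm, which ranges in `[0, log (n + 1)]`, and is checked by the sign
  -- of its slope.
  rcases le_total m (n / 2) with hm | hm
  · have haL' : Real.log (n + 1) - Real.log (n - m + 1) ≤ Real.log 2 := by
      rw [sub_le_iff_le_add, ← Real.log_mul (by norm_num) (by linarith)]
      exact Real.log_le_log (by linarith) (by linarith)
    have k := (abs_le.1 (q2 _ (sub_nonneg.2 haL) haL')).1
    rcases le_total φ 1 with h1 | h1
    · have : 0 ≤ (1 - φ) * Real.log (m + 1) := mul_nonneg (by linarith) hb0
      linarith
    · have : 0 ≤ (φ - 1) * (Real.log (n + 1) - Real.log (m + 1)) :=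
        mul_nonneg (by linarith) (by linarith)
      linarith
  · have hbL' : Real.log (n + 1) - Real.log (m + 1) ≤ Real.log 2 := by
      rw [sub_le_iff_le_add, ← Real.log_mul (by norm_num) (by linarith)]
      exact Real.log_le_log (by linarith) (by linarith)
    have k := (abs_le.1 (q1 _ (sub_nonneg.2 hbL) hbL')).1
    rcases le_total φ (1 / 2) with h1 | h1
    · have : 0 ≤ (1 / 2 - φ) * Real.log (n - m + 1) := mul_nonneg (by linarith) ha0
      linarith
    · have : 0 ≤ (φ - 1 / 2) * (Real.log (n + 1) - Real.log (n - m + 1)) :=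
        mul_nonneg (by linarith) (by linarith)
      linarith

/-- Constant configurations are competitors: total weight `1` for `φ ≤ 1`, total weight `n/2` for `φ
≥ 1`. -/
lemma exists_minFreeEnergyGap_le {φ σ : ℝ} (hφ : 0 < φ) (hσ : 0 < σ) :
    ∃ C, ∀ (n : ℕ) (x : Fin n → ℝ), 2 ≤ n →
      minFreeEnergyGap φ σ x ≤ min φ 1 * Real.log n + C := by
  obtain ⟨C, hC⟩ := exists_abs_entropyMin_add_mixingCost_sub_log_le hφ hσ one_pos
  refine ⟨C + φ * Real.log 2, fun n x hn => ?_⟩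
  have hn2 : (2 : ℝ) ≤ n := by exact_mod_cast hn
  have hl2 : 0 ≤ Real.log 2 := Real.log_nonneg (by norm_num)
  have hφl : 0 ≤ φ * Real.log 2 := by positivity
  rcases le_total φ 1 with h | h
  · have h1 := (abs_le.1 (hC n 1 le_rfl (by linarith) (by omega))).2
    have h2 := minFreeEnergyGap_le hφ hσ x one_pos (m := 1) (by linarith)
    rw [min_eq_left h]
    simp only [div_one, Real.log_one, add_zero] at h1
    linarith
  · have h1 := (abs_le.1 (hC n (n / 2) (by linarith) le_rfl (by omega))).2
    have h2 := minFreeEnergyGap_le hφ hσ x (m := n / 2) (by linarith) (by linarith)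
    rw [min_eq_right h]
    have e : (n : ℝ) / (n / 2) = 2 := by field_simp
    have h3 : Real.log (n / 2) ≤ Real.log n := Real.log_le_log (by linarith) (by linarith)
    rw [e] at h1
    linarith

lemma entropyMin_sub_le_of_logLikelihood_le {σ δ : ℝ} (hσ : 0 < σ) {n : ℕ} {x : Fin n → ℝ} {m : ℝ}
    (hm : 0 < m) (hn : m ≤ n)
    (h : ∀ t, logLikelihood (m / n) t x ≤ 2 * (1 / (4 * σ ^ 2)) * t ^ 2 + δ) :
    entropyMin n m - δ ≤ minEntropyMinusQuadratic σ x m := by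
  obtain ⟨y, hy, e⟩ := (isLeast_minEntropyMinusQuadratic hσ x hm.le hn).1
  obtain ⟨t, ht⟩ := exists_entropyMin_sub_logLikelihood_le hσ x hm hy
  have h1 := h t
  have h2 : 2 * (1 / (4 * σ ^ 2)) * t ^ 2 = t ^ 2 / (2 * σ ^ 2) := by field_simp; norm_num
  rw [← e]
  linarith

/-- A crude bound for tiny weights `m ≤ 1/n`, which the dyadic grid does not cover. -/
lemma quadraticTerm_le {σ : ℝ} (hσ : 0 < σ) {n : ℕ} (x : Fin n → ℝ) {y : Fin n → ℝ}
    (hy : y ∈ Configs n) :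
    quadraticTerm σ x y ≤ σ ^ 2 / 2 * ((∑ i, y i) ^ 2 * ∑ i, x i ^ 2) := by
  have hm := sum_nonneg_of_mem_configs hy
  have hcs := Finset.sum_mul_sq_le_sq_mul_sq Finset.univ x y
  have hy2 : ∑ i, y i ^ 2 ≤ (∑ i, y i) ^ 2 := by
    exact Finset.sum_sq_le_sq_sum_of_nonneg fun i _ => (hy i).1
  have hx : 0 ≤ ∑ i, x i ^ 2 := Finset.sum_nonneg fun i _ => sq_nonneg _
  have hS : (∑ i, x i * y i) ^ 2 ≤ (∑ i, y i) ^ 2 * ∑ i, x i ^ 2 := by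
    calc _ ≤ _ := hcs
      _ ≤ (∑ i, x i ^ 2) * (∑ i, y i) ^ 2 := by gcongr
      _ = _ := by ring
  unfold quadraticTerm
  have hA : 1 / σ ^ 2 ≤ ∑ i, y i + 1 / σ ^ 2 := by linarith
  calc _ ≤ (∑ i, x i * y i) ^ 2 / (2 * (1 / σ ^ 2)) := by gcongr
    _ = σ ^ 2 / 2 * (∑ i, x i * y i) ^ 2 := by field_simp
    _ ≤ _ := by gcongr

/-- The Gibbs bound is applied to the zero sample: the quadratic term vanishes and the likelihood
ratio is at most `1`. -/
lemma entropyMin_le_entropyTerm {n : ℕ} {y : Fin n → ℝ} (hy : y ∈ Configs n) :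
    entropyMin n (∑ i, y i) ≤ entropyTerm y := by
  rcases (sum_nonneg_of_mem_configs hy).eq_or_lt with h | h
  · have : ∀ i, y i = 0 := fun i =>
      (Finset.sum_eq_zero_iff_of_nonneg fun j _ => (hy j).1).1 h.symm i (Finset.mem_univ i)
    simp [entropyMin, entropyTerm, this]
  · obtain ⟨t, ht⟩ := exists_entropyMin_sub_logLikelihood_le one_pos (fun _ => 0) h ⟨hy, rfl⟩
    have h1 : logLikelihood ((∑ i, y i) / n) t (fun _ : Fin n => (0 : ℝ)) ≤ 0 := by
      have hp : 0 ≤ (∑ i, y i) / n := by positivity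
      have hp1 : (∑ i, y i) / n ≤ 1 := div_le_one_of_le₀ (sum_le_of_mem_configs hy) (by positivity)
      have he : Real.exp (t * 0 - t ^ 2 / 2) ≤ 1 := Real.exp_le_one_iff.2 (by nlinarith [sq_nonneg t])
      have he0 := Real.exp_pos (t * 0 - t ^ 2 / 2)
      exact Finset.sum_nonpos fun i _ => Real.log_nonpos
        (by nlinarith [mul_nonneg hp he0.le]) (by nlinarith)
    have h2 : quadraticTerm 1 (fun _ : Fin n => (0 : ℝ)) y = 0 := by simp [quadraticTerm]
    have h3 : 0 ≤ t ^ 2 / (2 * 1 ^ 2) := by positivity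
    unfold entropyMinusQuadratic at ht
    linarith

/-! ### Simultaneous control over all total weights. -/

/-- The samples for which the likelihood ratio is large on a dyadic grid of mixing ratios, or the
sum of squares is large. -/
def atypicalSamples (σ ε : ℝ) (n : ℕ) : Set (Fin n → ℝ) :=
  (⋃ j ∈ Finset.range ⌈4 * Real.log n⌉₊,
    {x | ∃ t : ℝ, 2 * (1 / (8 * σ ^ 2)) * t ^ 2 + ε * Real.log n
      < logLikelihood ((1 / 2) ^ (j + 1)) t x}) ∪ {x | (n : ℝ) ^ 2 ≤ ∑ i, x i ^ 2}

lemma lintegral_sum_sq_gaussianSample (n : ℕ) :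
    ∫⁻ x : Fin n → ℝ, ENNReal.ofReal (∑ i, x i ^ 2) ∂(gaussianSample n)
      = n * ∫⁻ x, ENNReal.ofReal (x ^ 2) ∂gaussianStd := by
  simp_rw [ENNReal.ofReal_sum_of_nonneg fun i (_ : i ∈ Finset.univ) => sq_nonneg _]
  rw [lintegral_finsetSum _ fun i _ => by fun_prop]
  have : ∀ i : Fin n, ∫⁻ x : Fin n → ℝ, ENNReal.ofReal (x i ^ 2) ∂(gaussianSample n)
      = ∫⁻ x, ENNReal.ofReal (x ^ 2) ∂gaussianStd := fun i =>
    (measurePreserving_eval (fun _ : Fin n => gaussianStd) i).lintegral_comp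
      (f := fun x => ENNReal.ofReal (x ^ 2)) (by fun_prop)
  simp [this]

lemma lintegral_sq_gaussianStd_ne_top : ∫⁻ x, ENNReal.ofReal (x ^ 2) ∂gaussianStd ≠ ⊤ := by
  have h : Integrable (fun x : ℝ => x ^ 2) gaussianStd := by
    simpa using integrable_pow_mul_exp_gaussianStd 2 0
  rw [← ofReal_integral_eq_lintegral_ofReal h (ae_of_all _ fun x => sq_nonneg x)]
  exact ENNReal.ofReal_ne_top

lemma measure_sum_sq_ge_le {n : ℕ} (hn : 1 ≤ n) :
    gaussianSample n {x | (n : ℝ) ^ 2 ≤ ∑ i, x i ^ 2}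
      ≤ (∫⁻ x, ENNReal.ofReal (x ^ 2) ∂gaussianStd) / n := by
  have hn0 : (n : ENNReal) ≠ 0 := by exact_mod_cast (by omega : n ≠ 0)
  have h := meas_ge_le_lintegral_div (μ := gaussianSample n)
    (f := fun x : Fin n → ℝ => ENNReal.ofReal (∑ i, x i ^ 2))
    (Measurable.aemeasurable (by fun_prop))
    (ε := (n : ENNReal) ^ 2) (by positivity) (by finiteness)
  rw [lintegral_sum_sq_gaussianSample] at h
  refine (measure_mono fun x hx => ?_).trans (h.trans (le_of_eq ?_))
  · have : ((n : ENNReal)) ^ 2 = ENNReal.ofReal ((n : ℝ) ^ 2) := by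
      rw [ENNReal.ofReal_pow (by positivity), ENNReal.ofReal_natCast]
    simp only [Set.mem_ofPred_eq] at hx ⊢
    rw [this]
    exact ENNReal.ofReal_le_ofReal hx
  · rw [pow_two, ENNReal.mul_div_mul_left _ _ hn0 (by finiteness)]

lemma tendsto_measure_atypicalSamples {σ ε : ℝ} (hσ : 0 < σ) (hε : 0 < ε) :
    Tendsto (fun n => gaussianSample n (atypicalSamples σ ε n)) atTop (𝓝 0) := by
  obtain ⟨C, hC0, hC⟩ := exists_lintegral_dampedVariation_le (c := 1 / (8 * σ ^ 2)) (by positivity)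
  have hlog : Tendsto (fun n : ℕ => Real.log n) atTop atTop :=
    Real.tendsto_log_atTop.comp tendsto_natCast_atTop_atTop
  have hb : ∀ᶠ n : ℕ in atTop, gaussianSample n (atypicalSamples σ ε n)
      ≤ ENNReal.ofReal (40 * C / ε ^ 2 / Real.log n)
        + (∫⁻ x, ENNReal.ofReal (x ^ 2) ∂gaussianStd) / n := by
    filter_upwards [hlog.eventually_ge_atTop 1, eventually_ge_atTop 1] with n hL hn
    refine (measure_union_le _ _).trans (add_le_add ?_ (measure_sum_sq_ge_le hn))
    have hL0 : 0 < Real.log n := by linarith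
    have hδ : 0 < ε * Real.log n := by positivity
    -- The quadratic part of the exponential makes each tail `O((log n)⁻²)`, which beats the `O(log
    -- n)` grid points of the union bound.
    have hy := Real.quadratic_le_exp_of_nonneg (x := ε * Real.log n / 2) (by positivity)
    have hden : (ε * Real.log n) ^ 2 / 8 ≤ Real.exp (ε * Real.log n / 2) - 1 := by nlinarith
    have hden0 : 0 < (ε * Real.log n) ^ 2 / 8 := by positivity
    have hj : ∀ j : ℕ, gaussianSample n {x | ∃ t : ℝ, 2 * (1 / (8 * σ ^ 2)) * t ^ 2
        + ε * Real.log n < logLikelihood ((1 / 2) ^ (j + 1)) t x}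
        ≤ ENNReal.ofReal (C / ((ε * Real.log n) ^ 2 / 8)) := by
      intro j
      have hp : ((1 : ℝ) / 2) ^ (j + 1) ≤ 1 / 2 := by
        rw [pow_succ]
        have : ((1 : ℝ) / 2) ^ j ≤ 1 := pow_le_one₀ (by norm_num) (by norm_num)
        linarith
      refine (measure_exists_lt_logLikelihood_le (by positivity) hδ (by positivity) hp
        (hC n _ (by positivity) hp)).trans ?_
      rw [← ENNReal.ofReal_div_of_pos (by linarith)]
      exact ENNReal.ofReal_le_ofReal (by gcongr)
    refine (measure_biUnion_finset_le _ _).trans ((Finset.sum_le_sum fun j _ => hj j).trans ?_)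
    rw [Finset.sum_const, Finset.card_range, nsmul_eq_mul, ← ENNReal.ofReal_natCast,
      ← ENNReal.ofReal_mul (by positivity)]
    refine ENNReal.ofReal_le_ofReal ?_
    have hceil : (⌈4 * Real.log n⌉₊ : ℝ) ≤ 5 * Real.log n := by
      have := Nat.ceil_lt_add_one (a := 4 * Real.log n) (by positivity)
      linarith
    calc _ ≤ 5 * Real.log n * (C / ((ε * Real.log n) ^ 2 / 8)) := by gcongr
      _ = _ := by field_simp; ring
  have t1 : Tendsto (fun n : ℕ => ENNReal.ofReal (40 * C / ε ^ 2 / Real.log n)) atTop (𝓝 0) := by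
    have := ENNReal.tendsto_ofReal (hlog.const_div_atTop (40 * C / ε ^ 2))
    rwa [ENNReal.ofReal_zero] at this
  have t2 : Tendsto (fun n : ℕ => (∫⁻ x, ENNReal.ofReal (x ^ 2) ∂gaussianStd) / n) atTop (𝓝 0) := by
    have := ENNReal.Tendsto.const_div ENNReal.tendsto_nat_nhds_top
      (a := ∫⁻ x, ENNReal.ofReal (x ^ 2) ∂gaussianStd) (Or.inr lintegral_sq_gaussianStd_ne_top)
    rwa [ENNReal.div_top] at this
  have t3 := t1.add t2
  rw [add_zero] at t3
  exact tendsto_of_tendsto_of_tendsto_of_le_of_le' tendsto_const_nhds t3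
    (Eventually.of_forall fun _ => zero_le) hb

lemma entropyMin_sub_le_of_notMem_atypicalSamples {σ ε : ℝ} (hσ : 0 < σ) (hε : 0 < ε) {n : ℕ}
    (hn : 2 ≤ n) {x : Fin n → ℝ} (hx : x ∉ atypicalSamples σ ε n) {y : Fin n → ℝ}
    (hy : y ∈ Configs n) :
    entropyMin n (∑ i, y i) - 2 * (ε * Real.log n) - σ ^ 2 / 2 ≤ entropyMinusQuadratic σ x y := by
  have hn2 : (2 : ℝ) ≤ n := by exact_mod_cast hn
  have hL : 0 < Real.log n := Real.log_pos (by linarith)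
  have hδ : 0 < ε * Real.log n := by positivity
  have hm0 := sum_nonneg_of_mem_configs hy
  have hmn := sum_le_of_mem_configs hy
  simp only [atypicalSamples, Set.mem_union, Set.mem_iUnion, Set.mem_ofPred_eq, not_or, not_exists,
    not_lt, not_le, Finset.mem_range] at hx
  obtain ⟨hx1, hx2⟩ := hx
  set m := ∑ i, y i with hm
  rcases le_or_gt m (1 / n) with h | h
  · have h1 := quadraticTerm_le hσ x hy
    have h2 := entropyMin_le_entropyTerm hy
    rw [← hm] at h1 h2
    have h3 : m ^ 2 * ∑ i, x i ^ 2 ≤ 1 := by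
      calc m ^ 2 * ∑ i, x i ^ 2 ≤ (1 / n) ^ 2 * (n : ℝ) ^ 2 := by gcongr
        _ = 1 := by field_simp
    have h4 : σ ^ 2 / 2 * (m ^ 2 * ∑ i, x i ^ 2) ≤ σ ^ 2 / 2 * 1 := by gcongr
    unfold entropyMinusQuadratic
    linarith
  · have hmpos : 0 < m := lt_trans (by positivity) h
    have hn0 : (0 : ℝ) < n := by linarith
    obtain ⟨t, ht⟩ := exists_entropyMin_sub_logLikelihood_le hσ x hmpos ⟨hy, hm.symm⟩
    have hp0 : 0 < m / n := by positivity
    have hp1 : m / n ≤ 1 := (div_le_one hn0).2 hmn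
    -- The ratio `m/n` lies in `(2^-(j+1), 2^-j]`; the lower end serves as grid point, so it is at
    -- most `1/2` and within a factor `2`.
    obtain ⟨j, hj1, hj2⟩ := exists_nat_pow_near_of_lt_one hp0 hp1 (y := (1 : ℝ) / 2)
      (by norm_num) (by norm_num)
    -- Here `m/n > n⁻²`, so `j log 2 < 2 log n`, and `log 2 > 1/2`.
    have hjlog : (j : ℝ) < 4 * Real.log n := by
      have a1 : 1 / (n : ℝ) ^ 2 < (1 / 2) ^ j := by
        refine lt_of_lt_of_le ?_ hj2
        rw [lt_div_iff₀ hn0]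
        calc 1 / (n : ℝ) ^ 2 * n = 1 / n := by field_simp
          _ < m := h
      have a2 := Real.log_lt_log (by positivity) a1
      rw [one_div, Real.log_inv, Real.log_pow, Real.log_pow, one_div, Real.log_inv] at a2
      have := Real.log_two_gt_d9
      push_cast at a2
      nlinarith [(j.cast_nonneg : (0 : ℝ) ≤ j)]
    have hxj := hx1 j (Nat.lt_ceil.2 hjlog) t
    set q : ℝ := (1 / 2) ^ (j + 1) with hq
    have hq0 : 0 < q := by positivity
    have hqhalf : q = (1 / 2) ^ j / 2 := by rw [hq, pow_succ]; ring
    have hq1 : q < 1 := by linarith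
    have hθ1 : 1 ≤ m / n / q := (one_le_div hq0).2 hj1.le
    have hθ2 : m / n / q ≤ 2 := by rw [div_le_iff₀ hq0]; linarith
    have hθq : m / n / q * q = m / n := div_mul_cancel₀ _ hq0.ne'
    have hl := logLikelihood_mul_le (t := t) x hq0.le hq1 hθ1 (by rw [hθq]; exact hp1)
    rw [hθq] at hl
    have hR : 0 ≤ 2 * (1 / (8 * σ ^ 2)) * t ^ 2 + ε * Real.log n := by positivity
    have hl2 : m / n / q * logLikelihood q t x
        ≤ 2 * (2 * (1 / (8 * σ ^ 2)) * t ^ 2 + ε * Real.log n) :=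
      calc _ ≤ m / n / q * (2 * (1 / (8 * σ ^ 2)) * t ^ 2 + ε * Real.log n) := by gcongr
        _ ≤ _ := by gcongr
    -- The damping `1/(8σ²)` on the grid is halved in advance: Bernoulli's factor `θ ≤ 2` restores
    -- exactly the prior penalty.
    have e : 2 * (2 * (1 / (8 * σ ^ 2)) * t ^ 2) = t ^ 2 / (2 * σ ^ 2) := by field_simp; norm_num
    have hσ2 : 0 ≤ σ ^ 2 / 2 := by positivity
    linarith

lemma exists_tail_le {C : ℝ} {ε : ENNReal} (hε : 0 < ε) :
    ∃ δ : ℝ, 0 < δ ∧ ENNReal.ofReal C / ENNReal.ofReal (Real.exp (δ / 2) - 1) ≤ ε := by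
  have h1 : Tendsto (fun δ : ℝ => Real.exp (δ / 2) - 1) atTop atTop :=
    tendsto_atTop_add_const_right _ _
      (Real.tendsto_exp_atTop.comp (tendsto_id.atTop_div_const (by norm_num)))
  have h2 : Tendsto (fun δ : ℝ => ENNReal.ofReal C / ENNReal.ofReal (Real.exp (δ / 2) - 1)) atTop
      (𝓝 0) := by
    have := ENNReal.Tendsto.const_div (ENNReal.tendsto_ofReal_atTop.comp h1)
      (a := ENNReal.ofReal C) (Or.inr ENNReal.ofReal_ne_top)
    rwa [ENNReal.div_top] at this
  obtain ⟨δ, hδ, hδ'⟩ := ((h2.eventually (Iic_mem_nhds hε)).and (eventually_gt_atTop 0)).exists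
  exact ⟨δ, hδ', hδ⟩

/-- From `1 - 1/z ≤ log z ≤ z - 1` at `z = 1 - m/n`. When `m²/n → 0` the entropy term simplifies to
`-m`. -/
lemma sub_mul_log_one_sub_add_mem {n m : ℝ} (hn : 0 < n) (hmn : m ≤ n / 2) :
    0 ≤ (n - m) * Real.log (1 - m / n) + m ∧
      (n - m) * Real.log (1 - m / n) + m ≤ m ^ 2 / n := by
  have h0 : 0 < n - m := by linarith
  have hz : 1 - m / n = (n - m) / n := by field_simp
  have hzpos : 0 < 1 - m / n := by rw [hz]; positivity
  have h1 := Real.log_le_sub_one_of_pos hzpos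
  have h2 := Real.one_sub_inv_le_log_of_pos hzpos
  have h1' := mul_le_mul_of_nonneg_left h1 h0.le
  have h2' := mul_le_mul_of_nonneg_left h2 h0.le
  have e1 : (n - m) * (1 - m / n - 1) = -m + m ^ 2 / n := by field_simp; ring
  have e2 : (n - m) * (1 - (1 - m / n)⁻¹) = -m := by rw [hz]; field_simp; ring
  constructor <;> linarith

lemma not_differentiableAt_min_one : ¬ DifferentiableAt ℝ (fun φ : ℝ => min φ 1) 1 := by
  intro h
  have h1 : DifferentiableAt ℝ (fun x : ℝ => x + 2 - 2 * min (x + 1) 1) 0 := by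
    have : DifferentiableAt ℝ (fun x : ℝ => min (x + 1) 1) 0 := by
      have h' : DifferentiableAt ℝ (fun φ : ℝ => min φ 1) ((fun x : ℝ => x + 1) 0) := by
        simpa using h
      exact h'.comp (f := fun x : ℝ => x + 1) 0 (by fun_prop)
    fun_prop
  -- `|x| = x + 2 - 2 min (x + 1) 1` carries the kink of the absolute value to `φ = 1`.
  refine not_differentiableAt_abs_zero (h1.congr_of_eventuallyEq (Eventually.of_forall fun x => ?_))
  beta_reduce
  rcases le_total x 0 with hx | hx
  · rw [abs_of_nonpos hx, min_eq_left (by linarith)]; ring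
  · rw [abs_of_nonneg hx, min_eq_right (by linarith)]; ring

lemma setOf_not_differentiableAt_min_one :
    {φ : ℝ | 0 < φ ∧ ¬ DifferentiableAt ℝ (fun φ : ℝ => min φ 1) φ} = {1} := by
  ext φ
  simp only [Set.mem_ofPred_eq, Set.mem_singleton_iff]
  constructor
  · rintro ⟨_, h⟩
    by_contra hne
    rcases lt_or_gt_of_ne hne with h1 | h1
    · refine h (differentiableAt_id.congr_of_eventuallyEq ?_)
      filter_upwards [Iio_mem_nhds h1] with z hz using min_eq_left (le_of_lt hz)
    · refine h ((differentiableAt_const (1 : ℝ)).congr_of_eventuallyEq ?_)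
      filter_upwards [Ioi_mem_nhds h1] with z hz using min_eq_right (le_of_lt hz)
  · rintro rfl
    exact ⟨one_pos, not_differentiableAt_min_one⟩

/-! ### The probabilistic conclusions. -/

section
variable {Ω : Type*} [MeasurableSpace Ω] {μ : Measure Ω}
  {X : ℕ → Ω → ℝ} {σ : ℝ}

/-- The upper bound by `entropyMin` holds for every sample, so only a large penalized likelihood
ratio can produce a deviation. The damping `1/(4σ²)` is the one for which `2 c t²` equals the
penalty `t²/(2σ²)`. -/
lemma measure_minEntropyMinusQuadratic_far_le (hX : ∀ i, HasLaw (X i) (gaussianReal 0 1) μ)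
    (hind : iIndepFun X μ) (hσ : 0 < σ) {n : ℕ} {m δ : ℝ} (hδ : 0 < δ) (hm : 0 < m)
    (hmn : m ≤ n / 2) {K : ENNReal}
    (hK : ∫⁻ x : Fin n → ℝ, dampedVariation (1 / (4 * σ ^ 2)) (m / n) x ∂(gaussianSample n) ≤ K) :
    μ {ω | δ < |minEntropyMinusQuadratic σ (sample X n ω) m - entropyMin n m|}
      ≤ K / ENNReal.ofReal (Real.exp (δ / 2) - 1) := by
  have hn0 : (0 : ℝ) < n := by linarith
  have hp : m / n ≤ 1 / 2 := by rw [div_le_iff₀ hn0]; linarith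
  refine le_trans ?_ ((measure_sample_le hX hind n _).trans (measure_exists_lt_logLikelihood_le
    (by positivity) hδ (by positivity) hp hK))
  refine measure_mono fun ω hω => ?_
  simp only [Set.mem_ofPred_eq] at hω ⊢
  by_contra! hcon
  have h1 := entropyMin_sub_le_of_logLikelihood_le hσ hm (by linarith) hcon
  have h2 := minEntropyMinusQuadratic_le hσ (sample X n ω) hm (by linarith)
  exact absurd hω (not_lt.2 (abs_le.2 ⟨by linarith, by linarith⟩))

lemma isBoundedInProbability_minEntropyMinusQuadratic
    (hX : ∀ i, HasLaw (X i) (gaussianReal 0 1) μ) (hind : iIndepFun X μ) (hσ : 0 < σ)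
    {n₁ : ℕ → ℝ} (hpos : ∀ n, 0 < n₁ n) (hlim : Tendsto (fun n : ℕ => n₁ n / n) atTop (𝓝 0)) :
    IsBoundedInProbability μ
      (fun n ω => minEntropyMinusQuadratic σ (sample X n ω) (n₁ n) - entropyMin n (n₁ n)) := by
  obtain ⟨C, hC0, hC⟩ := exists_lintegral_dampedVariation_le (c := 1 / (4 * σ ^ 2)) (by positivity)
  intro ε hε
  obtain ⟨δ, hδ, hδε⟩ := exists_tail_le (C := C) hε
  refine ⟨δ, ?_⟩
  filter_upwards [hlim.eventually (Iic_mem_nhds (by norm_num : (0 : ℝ) < 1 / 2)),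
    eventually_ge_atTop 1] with n hn hn1
  have hn0 : (0 : ℝ) < n := by exact_mod_cast hn1
  have hn' : n₁ n / n ≤ 1 / 2 := hn
  have hmn : n₁ n ≤ n / 2 := by rw [div_le_iff₀ hn0] at hn'; linarith
  have := hpos n
  exact (measure_minEntropyMinusQuadratic_far_le hX hind hσ hδ (hpos n) hmn
    (hC n _ (by positivity) hn')).trans hδε

lemma tendstoInMeasure_minEntropyMinusQuadratic
    (hX : ∀ i, HasLaw (X i) (gaussianReal 0 1) μ) (hind : iIndepFun X μ) (hσ : 0 < σ)
    {n₁ : ℕ → ℝ} (hpos : ∀ n, 0 < n₁ n)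
    (hlim : Tendsto (fun n : ℕ => n₁ n ^ 2 / n) atTop (𝓝 0)) :
    TendstoInMeasure μ
      (fun n ω => minEntropyMinusQuadratic σ (sample X n ω) (n₁ n)
        - (-(n₁ n) * Real.log n + n₁ n * Real.log (n₁ n) - n₁ n))
      atTop (fun _ => 0) := by
  rw [tendstoInMeasure_iff_dist]
  intro ε hε
  have htail : Tendsto (fun n : ℕ => variationBound (1 / (4 * σ ^ 2)) (n₁ n ^ 2 / n)
      / ENNReal.ofReal (Real.exp (ε / 3 / 2) - 1)) atTop (𝓝 0) := by
    have h0 := (tendsto_variationBound (c := 1 / (4 * σ ^ 2)) (by positivity)).comp hlim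
    have hpos : 0 < Real.exp (ε / 3 / 2) - 1 := by
      have := Real.add_one_lt_exp (x := ε / 3 / 2) (by positivity)
      have : 0 < ε / 3 / 2 := by positivity
      linarith
    have := ENNReal.Tendsto.div_const h0
      (b := ENNReal.ofReal (Real.exp (ε / 3 / 2) - 1)) (Or.inr (by simpa using hpos))
    rwa [ENNReal.zero_div] at this
  refine tendsto_of_tendsto_of_tendsto_of_le_of_le' tendsto_const_nhds htail
    (Eventually.of_forall fun _ => zero_le) ?_
  filter_upwards [hlim.eventually (Iic_mem_nhds (by norm_num : (0 : ℝ) < 1 / 4)),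
    hlim.eventually (Iic_mem_nhds (by positivity : (0 : ℝ) < ε / 3)),
    eventually_ge_atTop 1] with n hn hnε hn1
  have hn1' : (1 : ℝ) ≤ n := by exact_mod_cast hn1
  have hn0 : (0 : ℝ) < n := by linarith
  have hm := hpos n
  have hn' : n₁ n ^ 2 / n ≤ 1 / 4 := hn
  have hnε' : n₁ n ^ 2 / n ≤ ε / 3 := hnε
  -- `n₁² ≤ n/4` and `n ≥ 1` give `n₁² ≤ (n/2)²`.
  have hmn : n₁ n ≤ n / 2 := by
    rw [div_le_iff₀ hn0] at hn'
    refine (le_abs_self _).trans (abs_le_of_sq_le_sq ?_ (by positivity))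
    nlinarith
  have hp : n₁ n / n ≤ 1 / 2 := by rw [div_le_iff₀ hn0]; linarith
  have hN : (n : ℝ) * (n₁ n / n) ^ 2 = n₁ n ^ 2 / n := by field_simp
  have hK := lintegral_dampedVariation_le_variationBound (n := n) (1 / (4 * σ ^ 2))
    (p := n₁ n / n) (by positivity) hp
  rw [hN] at hK
  refine (measure_mono fun ω hω => ?_).trans
    (measure_minEntropyMinusQuadratic_far_le hX hind hσ (by positivity : 0 < ε / 3) hm hmn hK)
  simp only [Set.mem_ofPred_eq, Real.dist_eq, sub_zero] at hω ⊢
  by_contra! hcon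
  have h1 := sub_mul_log_one_sub_add_mem hn0 hmn
  rw [entropyMin_eq hm (by linarith), Real.log_div hm.ne' hn0.ne'] at hcon
  have h2 := abs_le.1 hcon
  -- One third of `ε` pays for the random fluctuation, one third for replacing the entropy by its
  -- expansion.
  have h3 : |minEntropyMinusQuadratic σ (sample X n ω) (n₁ n)
        - (-(n₁ n) * Real.log n + n₁ n * Real.log (n₁ n) - n₁ n)| ≤ 2 * ε / 3 :=
    abs_le.2 ⟨by linarith [h2.1, h1.1], by linarith [h2.2, h1.2]⟩
  linarith

lemma isBoundedInProbability_minFreeEnergyGapWithSum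
    (hX : ∀ i, HasLaw (X i) (gaussianReal 0 1) μ) (hind : iIndepFun X μ) (hσ : 0 < σ)
    {φ : ℝ} (hφ : 0 < φ) {n₁ : ℕ → ℝ} {c : ℝ} (hc : 0 < c) (hcn : ∀ n, c ≤ n₁ n)
    (hlim : Tendsto (fun n : ℕ => n₁ n / n) atTop (𝓝 0)) :
    IsBoundedInProbability μ
      (fun n ω => minFreeEnergyGapWithSum φ σ (sample X n ω) (n₁ n)
        - (φ * Real.log (n / n₁ n) + Real.log (n₁ n))) := by
  obtain ⟨C, hC⟩ := exists_abs_entropyMin_add_mixingCost_sub_log_le hφ hσ hc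
  intro ε hε
  obtain ⟨M, hM⟩ := isBoundedInProbability_minEntropyMinusQuadratic hX hind hσ
    (fun n => hc.trans_le (hcn n)) hlim ε hε
  refine ⟨M + C, ?_⟩
  filter_upwards [hM, hlim.eventually (Iic_mem_nhds (by norm_num : (0 : ℝ) < 1 / 2)),
    eventually_ge_atTop 1] with n hMn hn hn1
  have hn0 : (0 : ℝ) < n := by exact_mod_cast hn1
  have hn' : n₁ n / n ≤ 1 / 2 := hn
  have hmn : n₁ n ≤ n / 2 := by rw [div_le_iff₀ hn0] at hn'; linarith
  have hm : 0 < n₁ n := hc.trans_le (hcn n)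
  refine (measure_mono fun ω hω => ?_).trans hMn
  simp only [Set.mem_ofPred_eq] at hω ⊢
  rw [minFreeEnergyGapWithSum_eq hφ hσ _ hm.le (by linarith)] at hω
  by_contra! hcon
  have h1 := abs_le.1 (hC n (n₁ n) (hcn n) hmn hn1)
  have h2 := abs_le.1 hcon
  exact absurd hω (not_lt.2 (abs_le.2 ⟨by linarith [h1.1, h2.1], by linarith [h1.2, h2.2]⟩))

lemma tendstoInMeasure_minFreeEnergyGap_div_log
    (hX : ∀ i, HasLaw (X i) (gaussianReal 0 1) μ) (hind : iIndepFun X μ) (hσ : 0 < σ)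
    {φ : ℝ} (hφ : 0 < φ) :
    TendstoInMeasure μ (fun (n : ℕ) ω => minFreeEnergyGap φ σ (sample X n ω) / Real.log n)
      atTop (fun _ => min φ 1) := by
  obtain ⟨C₁, h₁⟩ := exists_minFreeEnergyGap_le hφ hσ
  obtain ⟨C₂, h₂⟩ := exists_min_mul_log_le_entropyMin_add_mixingCost hφ hσ
  rw [tendstoInMeasure_iff_dist]
  intro ε hε
  have hlog : Tendsto (fun n : ℕ => Real.log n) atTop atTop :=
    Real.tendsto_log_atTop.comp tendsto_natCast_atTop_atTop
  refine tendsto_of_tendsto_of_tendsto_of_le_of_le' tendsto_const_nhds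
    -- The likelihood bound loses twice `(ε/8) log n`, and the constants are eventually below `(ε/2)
    -- log n`; the total stays under `ε log n`.
    (tendsto_measure_atypicalSamples hσ (by positivity : 0 < ε / 8))
    (Eventually.of_forall fun _ => zero_le) ?_
  filter_upwards [hlog.eventually_gt_atTop (2 * C₁ / ε),
    hlog.eventually_gt_atTop (2 * (C₂ + σ ^ 2 / 2) / ε), eventually_ge_atTop 2] with n hL1 hL2 hn
  have hn2 : (2 : ℝ) ≤ n := by exact_mod_cast hn
  have hL : 0 < Real.log n := Real.log_pos (by linarith)
  refine le_trans (measure_mono fun ω hω => ?_) (measure_sample_le hX hind n _)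
  simp only [Set.mem_ofPred_eq, Real.dist_eq] at hω ⊢
  by_contra hcon
  have hup := h₁ n (sample X n ω) hn
  obtain ⟨y, hy, e⟩ := (isLeast_minFreeEnergyGap hφ hσ (sample X n ω)).1
  have hlow := entropyMin_sub_le_of_notMem_atypicalSamples hσ (by positivity) hn hcon hy
  have hdet := h₂ n (∑ i, y i) (sum_nonneg_of_mem_configs hy) (sum_le_of_mem_configs hy)
    (by omega)
  rw [freeEnergyGap_eq] at e
  rw [div_lt_iff₀ hε] at hL1 hL2
  refine absurd hω (not_le.2 ?_)
  have hεL : 0 < ε * Real.log n := by positivity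
  rw [abs_lt]
  constructor
  · rw [lt_sub_iff_add_lt, lt_div_iff₀ hL]
    linarith
  · rw [sub_lt_iff_lt_add, div_lt_iff₀ hL]
    linarith

end

theorem theorem2 {Ω : Type*} [MeasurableSpace Ω] (μ : Measure Ω) [IsProbabilityMeasure μ]
    (X : ℕ → Ω → ℝ) (hX : ∀ i, HasLaw (X i) (gaussianReal 0 1) μ) (hind : iIndepFun X μ)
    (σ : ℝ) (hσ : 0 < σ) :
    -- all the minima below are attained
    (∀ (n : ℕ) (x : Fin n → ℝ),
      (∀ m : ℝ, 0 ≤ m → m ≤ n →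
        IsLeast (entropyMinusQuadratic σ x '' ConfigsWithSum n m)
          (minEntropyMinusQuadratic σ x m) ∧
        ∀ φ : ℝ, 0 < φ → IsLeast (freeEnergyGap φ σ x '' ConfigsWithSum n m)
          (minFreeEnergyGapWithSum φ σ x m)) ∧
      ∀ φ : ℝ, 0 < φ → IsLeast (freeEnergyGap φ σ x '' Configs n) (minFreeEnergyGap φ σ x)) ∧
    -- the minimum of `f`, up to `o_p(1)`, when `n₁² / n → 0`
    (∀ n₁ : ℕ → ℝ, (∀ n, 0 < n₁ n) → Tendsto (fun n : ℕ => n₁ n ^ 2 / n) atTop (𝓝 0) →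
      TendstoInMeasure μ
        (fun n ω => minEntropyMinusQuadratic σ (sample X n ω) (n₁ n)
          - (-(n₁ n) * Real.log n + n₁ n * Real.log (n₁ n) - n₁ n))
        atTop (fun _ => 0)) ∧
    -- the minimum of `f`, up to `O_p(1)`, whenever `n₁ / n → 0`
    (∀ n₁ : ℕ → ℝ, (∀ n, 0 < n₁ n) → Tendsto (fun n : ℕ => n₁ n / n) atTop (𝓝 0) →
      IsBoundedInProbability μ
        (fun n ω => minEntropyMinusQuadratic σ (sample X n ω) (n₁ n)
          - (-(n₁ n) * Real.log n + n₁ n * Real.log (n₁ n)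
              + (n - n₁ n) * Real.log (1 - n₁ n / n)))) ∧
    -- the free energy whenever `n₁ / n → 0`
    (∀ φ : ℝ, 0 < φ → ∀ n₁ : ℕ → ℝ, (∃ c : ℝ, 0 < c ∧ ∀ n, c ≤ n₁ n) →
      Tendsto (fun n : ℕ => n₁ n / n) atTop (𝓝 0) →
      IsBoundedInProbability μ
        (fun n ω => minFreeEnergyGapWithSum φ σ (sample X n ω) (n₁ n)
          - (φ * Real.log (n / n₁ n) + Real.log (n₁ n)))) ∧
    -- the phase transition at `φ = 1`
    (∃ rate : ℝ → ℝ,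
      (∀ φ : ℝ, 0 < φ → TendstoInMeasure μ
        (fun (n : ℕ) ω => minFreeEnergyGap φ σ (sample X n ω) / Real.log n)
        atTop (fun _ => rate φ)) ∧
      (∀ φ : ℝ, 0 < φ → φ < 1 → rate φ = φ) ∧
      (∀ φ : ℝ, 1 ≤ φ → rate φ = 1) ∧
      {φ : ℝ | 0 < φ ∧ ¬ DifferentiableAt ℝ rate φ} = {1}) := by
  refine ⟨fun n x => ⟨fun m h0 hn => ⟨isLeast_minEntropyMinusQuadratic hσ x h0 hn,
      fun φ hφ => isLeast_minFreeEnergyGapWithSum hφ hσ x h0 hn⟩,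
      fun φ hφ => isLeast_minFreeEnergyGap hφ hσ x⟩,
    fun n₁ hpos hlim => tendstoInMeasure_minEntropyMinusQuadratic hX hind hσ hpos hlim,
    fun n₁ hpos hlim ε hε => ?_,
    fun φ hφ n₁ ⟨c, hc, hcn⟩ hlim =>
      isBoundedInProbability_minFreeEnergyGapWithSum hX hind hσ hφ hc hcn hlim,
    fun φ => min φ 1,
    fun φ hφ => tendstoInMeasure_minFreeEnergyGap_div_log hX hind hσ hφ,
    fun φ _ h => min_eq_left h.le, fun φ h => min_eq_right h,
    setOf_not_differentiableAt_min_one⟩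
  obtain ⟨M, hM⟩ := isBoundedInProbability_minEntropyMinusQuadratic hX hind hσ hpos hlim ε hε
  refine ⟨M, ?_⟩
  filter_upwards [hM, hlim.eventually (Iic_mem_nhds one_pos), eventually_ge_atTop 1]
    with n hMn hn hn1
  have hn0 : (0 : ℝ) < n := by exact_mod_cast hn1
  have hmn : n₁ n ≤ n := (div_le_one hn0).1 hn
  have e : entropyMin n (n₁ n) = -(n₁ n) * Real.log n + n₁ n * Real.log (n₁ n)
      + (n - n₁ n) * Real.log (1 - n₁ n / n) := by
    rw [entropyMin_eq (hpos n) hmn, Real.log_div (hpos n).ne' hn0.ne']; ring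
  rw [e] at hMn
  exact hMn
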